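/- **Setting.** Let $D\ge 0$ and $n\ge 1$ be integers, $L,R\ge 0$, let $\mathcal Z\subseteq\{z\in\mathbb R^D:\|z\|\le 1\}$ be any set, $\mathcal W=\{w\in\mathbb R^D:\|w\|\le R\}$, and $\ell(z,w)=-L\langle w,z\rangle$ for $z\in\mathcal Z$, $w\in\mathbb R^D$ (the problem instance $\mathcal P_{cvx}^{(D)}$). Let $\mu$ be a probability measure on $\mathcal Z$ and $\mathcal A$ a randomized learning algorithm, i.e. a Markov kernel $P_{W|S_n}$ from $\mathcal Z^n$ to $\mathcal W$. For $s=(z_1,\dots,z_n)$ put $\mathrm{gen}(s,w)=\mathbb E_{Z\sim\mu}[\ell(Z,w)]-\frac1n\sum_{i=1}^n\ell(z_i,w)$, and let $\mathrm{gen}(\mu,\mathcal A)=\mathbb E[\mathrm{gen}(S_n,W)]$ where $S_n\sim\mu^{\otimes n}$ and $W\sim P_{W|S_n}$. **The projection–compression CMI bound.** Let $\tilde S=(Z_{i,j})_{1\le i\le n,\,j\in\{0,1\}}$ have i.i.d. entries of law $\mu$, and let $J\in\{0,1\}^n$ be uniform and independent of $\tilde S$; write $\tilde S_J=(Z_{i,J_i})_{i}$.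 For $d\ge1$, a set $\hat{\mathcal W}\subseteq\mathbb R^d$, a law $P_\Theta$ on $\mathbb R^{D\times d}$ ($\Theta$ being independent of all the rest) and a Markov kernel $Q=P_{\hat W|\Theta^\top W}$ with values in $\hat{\mathcal W}$, define $$T(P_\Theta,Q)=\mathbb E_{\tilde S,\Theta}\left[\sqrt{\tfrac{2}{n}\,\Delta(\tilde S,\Theta)\,I^{\tilde S,\Theta}(\hat W;J)}\right],\qquad \Delta(\tilde S,\Theta)=\mathbb E\Big[\tfrac1n\sum_{i=1}^n\big(\ell(Z_{i,0},\Theta\hat W)-\ell(Z_{i,1},\Theta\hat W)\big)^2\,\Big|\,\tilde S,\Theta\Big],$$ where $I^{\tilde S,\Theta}(\hat W;J)$ is the mutual information (in nats) between $\hat W$ and $J$ for fixed $\tilde S,\Theta$, when $W\sim P_{W|S_n=\tilde S_J}$ and $\hat W\sim Q(\cdot\,|\,\Theta^\top W)$. The pair $(P_\Theta,Q)$ is $\tau$-admissible if $\mathbb E[\mathrm{gen}(S_n,W)-\mathrm{gen}(S_n,\Theta\hat W)]\le\tau$ (the expectation being absolutely convergent). The bound at level $\tau$ is $B_d(\tau,\hat{\mathcal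 W})=\tau+\inf T(P_\Theta,Q)$, the infimum being over all $\tau$-admissible pairs. **Theorem.** (1) For all $D,n,L,R,\mathcal Z,\mu,\mathcal A$ as above, $\mathrm{gen}(S_n,W)$ is integrable and $$\mathrm{gen}(\mu,\mathcal A)\le\frac{8LR}{\sqrt n},$$ and the projection–compression CMI bound with $d=1$ yields this value: let $P_\Theta$ be the law of a matrix in $\mathbb R^{D\times1}$ with i.i.d. standard Gaussian entries, and let $Q(\cdot\,|\,x)$ be the law of $x\,\mathbf 1\{|x|\le R\}+R\,V$ with $V$ uniform on $[-\frac25,\frac25]$. Then there are $\tau\in\mathbb R$ and $\hat{\mathcal W}\subseteq\mathbb R$ such that $(P_\Theta,Q)$ is $\tau$-admissible and $$\mathrm{gen}(\mu,\mathcal A)\le B_1(\tau,\hat{\mathcal W})\le T(P_\Theta,Q)+\tau\le\frac{8LR}{\sqrt n}.$$ (2) In particular, the bound is $O(\varepsilon)$ at sample sizes of the optimal order $(LR/\varepsilon)^2$: for every $c>0$ there is a constant $C>0$, depending only on $c$, such that for all $D,n,L,R,\mathcal Z,\mu,\mathcal A$ as above and all $\varepsilon>0$ with $n\ge c\,(LR/\varepsilon)^2$,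 $$\mathrm{gen}(\mu,\mathcal A)\le\frac{8LR}{\sqrt n}\le C\,\varepsilon .$$ -/

import Mathlib

open MeasureTheory ProbabilityTheory
open scoped ENNReal NNReal

noncomputable section

namespace ProjCMI

/-- The Euclidean space of dimension `D`, with the Euclidean norm and inner product. -/
abbrev Vec (D : ℕ) : Type := EuclideanSpace ℝ (Fin D)

/-- Real matrices with `D` rows and `d` columns, with the product (Borel) sigma-algebra. -/
abbrev ProjMat (D d : ℕ) : Type := Fin D → Fin d → ℝ

/-- The projection `Θᵀ w` of `w ∈ ℝ^D` to `ℝ^d`. -/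
def proj {D d : ℕ} (Θ : ProjMat D d) (w : Vec D) : Vec d :=
  WithLp.toLp 2 (fun k => ∑ i, Θ i k * w i)

/-- The vector `Θ v ∈ ℝ^D` obtained by mapping `v ∈ ℝ^d` back. -/
def unproj {D d : ℕ} (Θ : ProjMat D d) (v : Vec d) : Vec D :=
  WithLp.toLp 2 (fun i => ∑ k, Θ i k * v k)

theorem measurable_proj {D d : ℕ} :
    Measurable (fun p : ProjMat D d × Vec D => proj p.1 p.2) := by
  unfold proj
  fun_prop

section Risk

variable {Z : Type*} [MeasurableSpace Z] {D n : ℕ}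

/-- Population risk `E_{Z ∼ μ}[ℓ(Z, w)]`. -/
def popRisk (μ : Measure Z) (ℓ : Z → Vec D → ℝ) (w : Vec D) : ℝ :=
  ∫ z, ℓ z w ∂μ

/-- Empirical risk of `w` on the dataset `s = (s 0, …, s (n - 1))`. -/
def empRisk (ℓ : Z → Vec D → ℝ) (s : Fin n → Z) (w : Vec D) : ℝ :=
  (1 / (n : ℝ)) * ∑ i, ℓ (s i) w

/-- Generalization error of a hypothesis `w` with respect to a dataset `s`. -/
def genErr (μ : Measure Z) (ℓ : Z → Vec D → ℝ) (s : Fin n → Z) (w : Vec D) : ℝ :=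
  popRisk μ ℓ w - empRisk ℓ s w

/-- The law of a dataset of `n` i.i.d. samples of `μ`. -/
def sampleLaw (μ : Measure Z) (n : ℕ) : Measure (Fin n → Z) :=
  Measure.pi (fun _ => μ)

/-- The joint law of the dataset and of the output of the randomized learning algorithm `A`. -/
def trainLaw (μ : Measure Z) {𝒲 : Set (Vec D)} (A : Kernel (Fin n → Z) 𝒲) :
    Measure ((Fin n → Z) × 𝒲) :=
  sampleLaw μ n ⊗ₘ A

/-- Expected generalization error `gen(μ, A)` of the learning algorithm `A`. -/
def expGenErr (μ : Measure Z) (ℓ : Z → Vec D → ℝ) {𝒲 : Set (Vec D)}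
    (A : Kernel (Fin n → Z) 𝒲) : ℝ :=
  ∫ p, genErr μ ℓ p.1 (p.2 : Vec D) ∂(trainLaw μ A)

end Risk

section CMIBound

variable {Z : Type*} [MeasurableSpace Z] {D d n : ℕ}

/-- The law of the super-sample: `n` pairs `(Z_{i,0}, Z_{i,1})`, all entries i.i.d. from `μ`. -/
def superLaw (μ : Measure Z) (n : ℕ) : Measure (Fin n → Fin 2 → Z) :=
  Measure.pi (fun _ => Measure.pi (fun _ => μ))

/-- The law of the membership vector: `n` independent Bernoulli(1/2) bits. -/
def bitsLaw (n : ℕ) : Measure (Fin n → Fin 2) :=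
  Measure.pi (fun _ => (PMF.uniformOfFintype (Fin 2)).toMeasure)

/-- The training set selected from the super-sample `S` by the membership vector `J`. -/
def select (S : Fin n → Fin 2 → Z) (J : Fin n → Fin 2) : Fin n → Z := fun i => S i (J i)

/-- The compressed algorithm for a fixed projection matrix `Θ`: draw `W` from `A s`, then draw
the compressed model from the quantization kernel `Q` at `Θᵀ W`. -/
def compressed {𝒲 : Set (Vec D)} (A : Kernel (Fin n → Z) 𝒲) (Q : Kernel (Vec d) (Vec d))
    (Θ : ProjMat D d) : Kernel (Fin n → Z) (Vec d) :=
  Q ∘ₖ (A.map (fun w : 𝒲 => proj Θ (w : Vec D)))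

/-- The joint law of `(J, Ŵ)` for a given super-sample `S` and a given projection matrix `Θ`. -/
def bitsModelLaw {𝒲 : Set (Vec D)} (A : Kernel (Fin n → Z) 𝒲) (Q : Kernel (Vec d) (Vec d))
    (S : Fin n → Fin 2 → Z) (Θ : ProjMat D d) : Measure ((Fin n → Fin 2) × Vec d) :=
  bitsLaw n ⊗ₘ ((compressed A Q Θ).comap (select S) Measurable.of_discrete)

/-- The disintegrated conditional mutual information (in nats) between the compressed model and
the membership vector, for a given super-sample `S` and a given projection matrix `Θ`: the
Kullback-Leibler divergence of the joint law from the product of its marginals. -/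
def dcmi {𝒲 : Set (Vec D)} (A : Kernel (Fin n → Z) 𝒲) (Q : Kernel (Vec d) (Vec d))
    (S : Fin n → Fin 2 → Z) (Θ : ProjMat D d) : ℝ≥0∞ :=
  InformationTheory.klDiv (bitsModelLaw A Q S Θ)
    ((bitsModelLaw A Q S Θ).fst.prod (bitsModelLaw A Q S Θ).snd)

/-- The average squared loss difference
`E[(1/n) ∑ i, (ℓ(Z_{i,0}, Θ Ŵ) - ℓ(Z_{i,1}, Θ Ŵ))²]` for a given super-sample and matrix. -/
def lossGap (ℓ : Z → Vec D → ℝ) {𝒲 : Set (Vec D)} (A : Kernel (Fin n → Z) 𝒲)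
    (Q : Kernel (Vec d) (Vec d)) (S : Fin n → Fin 2 → Z) (Θ : ProjMat D d) : ℝ≥0∞ :=
  ∫⁻ v, ENNReal.ofReal ((1 / (n : ℝ)) *
    ∑ i, (ℓ (S i 0) (unproj Θ v) - ℓ (S i 1) (unproj Θ v)) ^ 2) ∂(bitsModelLaw A Q S Θ).snd

/-- The expectation, over the super-sample and the projection matrix, of
`√((2 / n) * lossGap * dcmi)`. -/
def cmiTerm (μ : Measure Z) (ℓ : Z → Vec D → ℝ) {𝒲 : Set (Vec D)} (A : Kernel (Fin n → Z) 𝒲)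
    (P : Measure (ProjMat D d)) (Q : Kernel (Vec d) (Vec d)) : ℝ≥0∞ :=
  ∫⁻ S, ∫⁻ Θ, (ENNReal.ofReal (2 / (n : ℝ)) * lossGap ℓ A Q S Θ * dcmi A Q S Θ) ^ (1 / 2 : ℝ)
    ∂P ∂(superLaw μ n)

/-- The joint law of `(((S_n, W), Θ), Ŵ)`: `Θ` is independent of `(S_n, W)`, and `Ŵ` is drawn
from `Q` at `Θᵀ W`. -/
def fullLaw (μ : Measure Z) {𝒲 : Set (Vec D)} (A : Kernel (Fin n → Z) 𝒲)
    (P : Measure (ProjMat D d)) (Q : Kernel (Vec d) (Vec d)) :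
    Measure ((((Fin n → Z) × 𝒲) × ProjMat D d) × Vec d) :=
  ((trainLaw μ A).prod P) ⊗ₘ
    (Q.comap (fun p : ((Fin n → Z) × 𝒲) × ProjMat D d => proj p.2 (p.1.2 : Vec D))
      (measurable_proj.comp
        (measurable_snd.prodMk (measurable_subtype_coe.comp (measurable_snd.comp measurable_fst)))))

/-- The distribution `P` of the projection matrix and the quantization kernel `Q`, with values in
`What`, satisfy the distortion criterion at level `τ`. -/
structure IsAdmissible (μ : Measure Z) (ℓ : Z → Vec D → ℝ) {𝒲 : Set (Vec D)}
    (A : Kernel (Fin n → Z) 𝒲) (What : Set (Vec d)) (τ : ℝ)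
    (P : Measure (ProjMat D d)) (Q : Kernel (Vec d) (Vec d)) : Prop where
  isProbabilityMeasure : IsProbabilityMeasure P
  isMarkovKernel : IsMarkovKernel Q
  mem_What : ∀ x, ∀ᵐ v ∂(Q x), v ∈ What
  integrable : Integrable
    (fun p => genErr μ ℓ p.1.1.1 (p.1.1.2 : Vec D) - genErr μ ℓ p.1.1.1 (unproj p.1.2 p.2))
    (fullLaw μ A P Q)
  distortion_le :
    ∫ p, (genErr μ ℓ p.1.1.1 (p.1.1.2 : Vec D) - genErr μ ℓ p.1.1.1 (unproj p.1.2 p.2))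
      ∂(fullLaw μ A P Q) ≤ τ

/-- The generalization bound by stochastic projection and lossy compression, at distortion level
`τ`, projection dimension `d` and quantization set `What`: the infimum of `cmiTerm` over all
admissible choices of the projection distribution and of the quantization kernel, plus `τ`. -/
def cmiBound (μ : Measure Z) (ℓ : Z → Vec D → ℝ) {𝒲 : Set (Vec D)} (A : Kernel (Fin n → Z) 𝒲)
    (What : Set (Vec d)) (τ : ℝ) : EReal :=
  ((⨅ (P : Measure (ProjMat D d)) (Q : Kernel (Vec d) (Vec d))
      (_ : IsAdmissible μ ℓ A What τ P Q), cmiTerm μ ℓ A P Q : ℝ≥0∞) : EReal) + (τ : EReal)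

end CMIBound

section JohnsonLindenstrauss

/-- The law of a `D × d` matrix with i.i.d. centered Gaussian entries of variance `1 / d`. -/
def jlLaw (D d : ℕ) : Measure (ProjMat D d) :=
  Measure.pi (fun _ => Measure.pi (fun _ => gaussianReal 0 (1 / (d : ℝ≥0))))

open Classical in
/-- `x` itself if `‖x‖ ≤ r`, and the zero vector otherwise. -/
def truncate {d : ℕ} (r : ℝ) (x : Vec d) : Vec d := if ‖x‖ ≤ r then x else 0

/-- The quantization kernel at scale `R`: from `x`, the law of `truncate (c * R) x + R • V` with
`V` uniformly distributed on the ball of radius `ν`. -/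
def jlKernel (d : ℕ) (c ν R : ℝ) : Kernel (Vec d) (Vec d) :=
  (Kernel.id ×ₖ Kernel.const (Vec d)
      ((volume : Measure (Vec d))[|Metric.closedBall (0 : Vec d) ν])).map
    (fun p => truncate (c * R) p.1 + R • p.2)

end JohnsonLindenstrauss

/-- The linear loss `ℓ(z, w) = -L ⟨w, z⟩` of the convex problem instance with data in `𝒵`. -/
def linLoss {D : ℕ} (L : ℝ) (𝒵 : Set (Vec D)) (z : 𝒵) (w : Vec D) : ℝ :=
  -L * inner ℝ w (z : Vec D)

end ProjCMI

end

/-! For the linear loss the generalization error of `w` on `s` is `L ⟪w, meanDev μ s⟫`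
(`genErr_linLoss`), and the mean of `n` independent vectors of the unit ball deviates from its
expectation by at most `1/√n` on average, in any dimension. Both halves of the bound live at this
scale, so the projection need not approximate anything: one Gaussian column `g` suffices, because `E
⟪g, u⟫² = ‖u‖²`.

Distortion: the triangle inequality treats `W` and `Θ Ŵ` separately. Since `|Ŵ| ≤ (7/5) R`, their
errors are at most `L R ‖meanDev‖` and `(7/5) L R |⟪g, meanDev⟫|`, in total `(12/5) L R / √n` on
average (`distortion_jlKernel`).

Information: for `R > 0` and any input, `Ŵ` is uniform on an interval of length `(4/5) R` inside a
fixed one of length `(14/5) R`. Its law has density at most `7/2` with respect to a fixed law, so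
the mutual information is at most `log (7/2) ≤ 2` (`jlKernel_le_smul`, `dcmi_le_log`). As `E ⟪g, z -
z'⟫² ≤ 4`, the CMI term is at most `√((2/n) · 4 (7 L R / 5)² · 2) = (28/5) L R / √n`, and `28/5 +
12/5 = 8`.

That `cmiBound` dominates the generalization error is shown for every admissible pair with bounded
quantization set. Exchanging training points with ghost points turns the error into an average with
random signs; Donsker-Varadhan and the sub-Gaussian bound for signs give an inequality quadratic in
a parameter `t`, and its discriminant condition is the square root bound
(`ofReal_integral_signedMean_le`). -/

open MeasureTheory ProbabilityTheory
open scoped ENNReal NNReal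

noncomputable section

namespace ProjCMI

/-! ### Kullback-Leibler divergence: domination, variational bound, mutual information. -/

section KL

open InformationTheory

variable {α β : Type*} [MeasurableSpace α] [MeasurableSpace β]

/-- Domination by a multiple of a probability measure bounds the Kullback-Leibler divergence. -/
theorem klDiv_le_log_of_le_smul {ρ ν : Measure α} [IsProbabilityMeasure ρ]
    [IsProbabilityMeasure ν] {C : ℝ} (hC : 1 ≤ C) (h : ρ ≤ ENNReal.ofReal C • ν) :
    klDiv ρ ν ≤ ENNReal.ofReal (Real.log C) := by
  have hac : ρ ≪ ν := (Measure.absolutelyContinuous_of_le h).trans Measure.smul_absolutelyContinuous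
  have hr : ρ.rnDeriv ν ≤ᵐ[ν] fun _ => ENNReal.ofReal C := by
    refine ae_le_of_forall_setLIntegral_le_of_sigmaFinite (Measure.measurable_rnDeriv _ _) ?_
    intro s _ _
    rw [setLIntegral_const]
    refine (Measure.setLIntegral_rnDeriv_le s).trans ?_
    simpa using h s
  have hint : Integrable (fun x => (ρ.rnDeriv ν x).toReal) ν := Measure.integrable_toReal_rnDeriv
  rw [klDiv_eq_lintegral_klFun_of_ac hac]
  -- With `r` the density, `klFun r = r log r + 1 - r` and `r ≤ C`; the correction `1 - r`
  -- integrates to zero.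
  have hle : ∀ᵐ x ∂ν, klFun (ρ.rnDeriv ν x).toReal
      ≤ (ρ.rnDeriv ν x).toReal * Real.log C + (1 - (ρ.rnDeriv ν x).toReal) := by
    filter_upwards [hr] with x hx
    have h0 : 0 ≤ (ρ.rnDeriv ν x).toReal := ENNReal.toReal_nonneg
    have h1 : (ρ.rnDeriv ν x).toReal ≤ C := ENNReal.toReal_le_of_le_ofReal (by linarith) hx
    rw [klFun_apply]
    rcases h0.eq_or_lt with h0 | h0
    · simp [← h0]
    · have := mul_le_mul_of_nonneg_left (Real.log_le_log h0 h1) h0.le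
      linarith
  have hnn : 0 ≤ᵐ[ν] fun x =>
      (ρ.rnDeriv ν x).toReal * Real.log C + (1 - (ρ.rnDeriv ν x).toReal) := by
    filter_upwards [hle] with x hx using (klFun_nonneg ENNReal.toReal_nonneg).trans hx
  have hint1 : Integrable (fun x => (ρ.rnDeriv ν x).toReal * Real.log C) ν := hint.mul_const _
  have hint2 : Integrable (fun x => 1 - (ρ.rnDeriv ν x).toReal) ν := (integrable_const _).sub hint
  calc ∫⁻ x, ENNReal.ofReal (klFun (ρ.rnDeriv ν x).toReal) ∂ν
      ≤ ∫⁻ x, ENNReal.ofReal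
          ((ρ.rnDeriv ν x).toReal * Real.log C + (1 - (ρ.rnDeriv ν x).toReal)) ∂ν :=
        lintegral_mono_ae (hle.mono fun x hx => ENNReal.ofReal_le_ofReal hx)
    _ = ENNReal.ofReal (∫ x,
          ((ρ.rnDeriv ν x).toReal * Real.log C + (1 - (ρ.rnDeriv ν x).toReal)) ∂ν) :=
        (ofReal_integral_eq_lintegral_ofReal (hint1.add hint2) hnn).symm
    _ = ENNReal.ofReal (Real.log C) := by
        rw [integral_add hint1 hint2, integral_sub (integrable_const _) hint, integral_mul_const,
          Measure.integral_toReal_rnDeriv hac]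
        simp

/-- A weak form of the Donsker-Varadhan inequality. -/
theorem ofReal_integral_le_klDiv {ρ ν : Measure α} [IsProbabilityMeasure ρ]
    [IsProbabilityMeasure ν] {g : α → ℝ} (hg : Measurable g) (hgi : Integrable g ρ)
    (hexp : ∫⁻ x, ENNReal.ofReal (Real.exp (g x)) ∂ν ≤ 1) :
    ENNReal.ofReal (∫ x, g x ∂ρ) ≤ klDiv ρ ν := by
  by_cases hkl : klDiv ρ ν = ∞
  · simp [hkl]
  obtain ⟨hac, hllr⟩ := klDiv_ne_top_iff.mp hkl
  have hexpi : Integrable (fun x => Real.exp (g x)) ν := by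
    refine ⟨(Real.measurable_exp.comp hg).aestronglyMeasurable, ?_⟩
    rw [hasFiniteIntegral_iff_ofReal (Filter.Eventually.of_forall fun x => (Real.exp_pos _).le)]
    exact hexp.trans_lt ENNReal.one_lt_top
  have hexp' : ∫ x, Real.exp (g x) ∂ν ≤ 1 := by
    rw [integral_eq_lintegral_of_nonneg_ae
      (Filter.Eventually.of_forall fun x => (Real.exp_pos _).le) hexpi.aestronglyMeasurable]
    exact ENNReal.toReal_le_of_le_ofReal zero_le_one (by simpa using hexp)
  -- The Fenchel-Young inequality for `klFun`: it is `y + 1 ≤ exp y` at `y = g - log r`, multiplied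
  -- by `r`.
  have hkey : ∀ x, (ρ.rnDeriv ν x).toReal * g x ≤
      klFun (ρ.rnDeriv ν x).toReal + (Real.exp (g x) - 1) := by
    intro x
    have h0 : 0 ≤ (ρ.rnDeriv ν x).toReal := ENNReal.toReal_nonneg
    generalize (ρ.rnDeriv ν x).toReal = r at h0
    rw [klFun_apply]
    rcases h0.eq_or_lt with h0 | h0
    · simpa [← h0] using (Real.exp_pos (g x)).le
    · have h1 := Real.add_one_le_exp (g x - Real.log r)
      have h2 : Real.exp (g x - Real.log r) = Real.exp (g x) / r := by
        rw [Real.exp_sub, Real.exp_log h0]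
      rw [h2, le_div_iff₀ h0] at h1
      nlinarith
  have hki : Integrable (fun x => klFun (ρ.rnDeriv ν x).toReal) ν :=
    (integrable_klFun_rnDeriv_iff hac).mpr hllr
  have hgi' : Integrable (fun x => (ρ.rnDeriv ν x).toReal * g x) ν := by
    simpa using (integrable_rnDeriv_smul_iff hac).mpr hgi
  have h1 : ∫ x, g x ∂ρ ≤ (klDiv ρ ν).toReal := by
    have e : ∫ x, g x ∂ρ = ∫ x, (ρ.rnDeriv ν x).toReal * g x ∂ν := by
      simpa using (integral_rnDeriv_smul (f := g) hac).symm
    rw [e, toReal_klDiv_eq_integral_klFun hac]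
    calc _ ≤ ∫ x, (klFun (ρ.rnDeriv ν x).toReal + (Real.exp (g x) - 1)) ∂ν :=
          integral_mono hgi' (hki.add (hexpi.sub (integrable_const _))) hkey
      _ = ∫ x, klFun (ρ.rnDeriv ν x).toReal ∂ν + (∫ x, Real.exp (g x) ∂ν - 1) := by
          have hi2 : Integrable (fun x => Real.exp (g x) - 1) ν := hexpi.sub (integrable_const _)
          rw [integral_add hki hi2, integral_sub hexpi (integrable_const _)]
          simp
      _ ≤ _ := by linarith
  exact ENNReal.ofReal_le_of_le_toReal h1

theorem klDiv_map_swap_le (ρ ν : Measure (α × β)) [IsFiniteMeasure ρ] [IsFiniteMeasure ν] :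
    klDiv ρ ν ≤ klDiv (ρ.map Prod.swap) (ν.map Prod.swap) := by
  have := klDiv_map_le (ρ.map Prod.swap) (ν.map Prod.swap) (g := Prod.swap) measurable_swap
  simpa [Measure.map_map measurable_swap measurable_swap] using this

/-- The mutual information is at most the divergence from any product with the same first
marginal. -/
theorem klDiv_fst_prod_snd_le [StandardBorelSpace α] [Nonempty α] (ρ : Measure (α × β))
    [IsProbabilityMeasure ρ] (q : Measure β) [IsProbabilityMeasure q] :
    klDiv ρ (ρ.fst.prod ρ.snd) ≤ klDiv ρ (ρ.fst.prod q) := by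
  have hfst : (ρ.map Prod.swap).fst = ρ.snd := Measure.fst_map_swap
  have hd : ρ.snd ⊗ₘ (ρ.map Prod.swap).condKernel = ρ.map Prod.swap := by
    rw [← hfst]; exact Measure.disintegrate _ _
  have hp : ∀ m : Measure β, SFinite m →
      (ρ.fst.prod m).map Prod.swap = m ⊗ₘ Kernel.const β ρ.fst := by
    intro m _
    rw [Measure.prod_swap, Measure.compProd_const]
  -- The chain rule splits off the first coordinate, so the pair is swapped: the divergence from the
  -- product with `q` exceeds the mutual information by `klDiv ρ.snd q`.
  calc klDiv ρ (ρ.fst.prod ρ.snd)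
      ≤ klDiv (ρ.map Prod.swap) ((ρ.fst.prod ρ.snd).map Prod.swap) := klDiv_map_swap_le _ _
    _ ≤ klDiv (ρ.map Prod.swap) ((ρ.fst.prod q).map Prod.swap) := by
        rw [hp _ inferInstance, hp _ inferInstance, ← hd,
          klDiv_compProd_eq_add ρ.snd q]
        exact le_add_self
    _ ≤ klDiv ρ (ρ.fst.prod q) := klDiv_map_le _ _ measurable_swap

end KL

/-! ### Random signs and the mutual information inequality for a fixed super-sample. -/

section Rademacher

open InformationTheory

instance (n : ℕ) : IsProbabilityMeasure (bitsLaw n) := by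
  unfold bitsLaw; infer_instance

/-- The sign attached to a membership bit. -/
def bitSign (j : Fin 2) : ℝ := if j = 0 then -1 else 1

theorem abs_bitSign (j : Fin 2) : |bitSign j| = 1 := by
  unfold bitSign; split_ifs <;> norm_num

/-- Independence factors the expectation into `cosh (a i)`, and `cosh x ≤ exp (x² / 2)`. -/
theorem integral_bits_exp_le {n : ℕ} (a : Fin n → ℝ) :
    ∫ J, Real.exp (∑ i, bitSign (J i) * a i) ∂(bitsLaw n) ≤ Real.exp (∑ i, a i ^ 2 / 2) := by
  simp_rw [Real.exp_sum]
  rw [bitsLaw, integral_fintype_prod_eq_prod (f := fun i j => Real.exp (bitSign j * a i))]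
  refine Finset.prod_le_prod (fun i _ => integral_nonneg fun j => (Real.exp_pos _).le) ?_
  intro i _
  refine le_trans (le_of_eq ?_) (Real.cosh_le_exp_half_sq (a i))
  rw [PMF.integral_eq_sum, Real.cosh_eq]
  simp [bitSign]
  ring

variable {V : Type*} {n : ℕ}

/-- The signed average of the loss differences. -/
def signedMean (d : Fin n → V → ℝ) (p : (Fin n → Fin 2) × V) : ℝ :=
  (1 / (n : ℝ)) * ∑ i, bitSign (p.1 i) * d i p.2

/-- The mean square of the loss differences. -/
def meanSq (d : Fin n → V → ℝ) (v : V) : ℝ := (1 / (n : ℝ)) * ∑ i, d i v ^ 2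

theorem meanSq_nonneg (d : Fin n → V → ℝ) (v : V) : 0 ≤ meanSq d v := by
  unfold meanSq; positivity

theorem abs_signedMean_le {d : Fin n → V → ℝ} {M : ℝ} (hn : 1 ≤ n) (J : Fin n → Fin 2) {v : V}
    (h : ∀ i, |d i v| ≤ M) : |signedMean d (J, v)| ≤ M := by
  have hn' : (0 : ℝ) < n := by exact_mod_cast hn
  unfold signedMean
  rw [abs_mul, abs_of_pos (by positivity), one_div, inv_mul_le_iff₀ hn']
  refine (Finset.abs_sum_le_sum_abs _ _).trans ?_
  refine (Finset.sum_le_sum (g := fun _ => M) fun i _ => ?_).trans (by simp)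
  rw [abs_mul, abs_bitSign, one_mul]; exact h i

theorem meanSq_le {d : Fin n → V → ℝ} {M : ℝ} (hn : 1 ≤ n) {v : V}
    (h : ∀ i, d i v ^ 2 ≤ M) : meanSq d v ≤ M := by
  have hn' : (0 : ℝ) < n := by exact_mod_cast hn
  unfold meanSq
  rw [one_div, inv_mul_le_iff₀ hn']
  exact (Finset.sum_le_sum (g := fun _ => M) fun i _ => h i).trans (by simp)

/-- Needed when the divergence is infinite: there `0 * ∞ = 0` on the right, so the left side must be
shown to vanish. -/
theorem signedMean_eq_zero_of_meanSq {d : Fin n → V → ℝ} (hn : 1 ≤ n) {v : V}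
    (h : meanSq d v = 0) (J : Fin n → Fin 2) : signedMean d (J, v) = 0 := by
  have hn' : (n : ℝ) ≠ 0 := by positivity
  unfold meanSq at h
  have h1 : ∑ i, d i v ^ 2 = 0 := by
    rcases mul_eq_zero.mp h with h | h
    · simp [hn'] at h
    · exact h
  rw [Finset.sum_eq_zero_iff_of_nonneg fun i _ => sq_nonneg _] at h1
  unfold signedMean
  rw [Finset.sum_eq_zero, mul_zero]
  intro i hi
  simp [pow_eq_zero_iff two_ne_zero |>.mp (h1 i hi)]

variable [MeasurableSpace V]

theorem measurable_meanSq {d : Fin n → V → ℝ} (hd : ∀ i, Measurable (d i)) :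
    Measurable (meanSq d) := by
  unfold meanSq; fun_prop

theorem measurable_signedMean {d : Fin n → V → ℝ} (hd : ∀ i, Measurable (d i)) :
    Measurable (signedMean d) := by
  have : ∀ i, Measurable fun p : (Fin n → Fin 2) × V => bitSign (p.1 i) := fun i =>
    (Measurable.of_discrete (f := bitSign)).comp ((measurable_pi_apply i).comp measurable_fst)
  unfold signedMean; fun_prop

/-- Under the product law the signs are independent of `v`, so `integral_bits_exp_le` applies for
each `v` with `a i = t * d i v / n`. The subtracted term is exactly the resulting exponent, which
makes the exponent admissible in `ofReal_integral_le_klDiv`. -/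
theorem lintegral_exp_signedMean_le {d : Fin n → V → ℝ} (hd : ∀ i, Measurable (d i))
    (m : Measure V) [IsProbabilityMeasure m] (t : ℝ) :
    ∫⁻ p, ENNReal.ofReal (Real.exp (t * signedMean d p - t ^ 2 / (2 * n) * meanSq d p.2))
      ∂((bitsLaw n).prod m) ≤ 1 := by
  have hmeas : Measurable fun p : (Fin n → Fin 2) × V =>
      ENNReal.ofReal (Real.exp (t * signedMean d p - t ^ 2 / (2 * n) * meanSq d p.2)) := by
    have h1 := measurable_signedMean hd
    have h2 : Measurable fun p : (Fin n → Fin 2) × V => meanSq d p.2 :=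
      (measurable_meanSq hd).comp measurable_snd
    exact ((h1.const_mul _).sub (h2.const_mul _)).exp.ennreal_ofReal
  rw [lintegral_prod_symm _ hmeas.aemeasurable]
  calc _ ≤ ∫⁻ _, 1 ∂m := lintegral_mono fun v => ?_
    _ = 1 := by simp
  rw [← ofReal_integral_eq_lintegral_ofReal Integrable.of_finite
    (Filter.Eventually.of_forall fun _ => (Real.exp_pos _).le)]
  refine ENNReal.ofReal_le_one.mpr ?_
  simp_rw [Real.exp_sub, integral_div]
  rw [div_le_one (Real.exp_pos _)]
  have h := integral_bits_exp_le fun i => t * (1 / (n : ℝ)) * d i v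
  have e1 : ∀ J : Fin n → Fin 2, ∑ i, bitSign (J i) * (t * (1 / (n : ℝ)) * d i v)
      = t * signedMean d (J, v) := by
    intro J
    simp only [signedMean, Finset.mul_sum]
    exact Finset.sum_congr rfl fun i _ => by ring
  have e2 : ∑ i, (t * (1 / (n : ℝ)) * d i v) ^ 2 / 2 = t ^ 2 / (2 * n) * meanSq d v := by
    simp only [meanSq, Finset.mul_sum]
    exact Finset.sum_congr rfl fun i _ => by ring
  simpa only [e1, e2] using h

theorem integrable_signedMean (hn : 1 ≤ n) {ρ : Measure ((Fin n → Fin 2) × V)}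
    [IsFiniteMeasure ρ] {d : Fin n → V → ℝ} (hd : ∀ i, Measurable (d i)) {M : ℝ}
    (hM : ∀ᵐ p ∂ρ, ∀ i, |d i p.2| ≤ M) : Integrable (signedMean d) ρ := by
  refine Integrable.of_bound (measurable_signedMean hd).aestronglyMeasurable M ?_
  filter_upwards [hM] with p hp using abs_signedMean_le hn p.1 hp

theorem integrable_meanSq (hn : 1 ≤ n) {ρ : Measure V}
    [IsFiniteMeasure ρ] {d : Fin n → V → ℝ} (hd : ∀ i, Measurable (d i)) {M : ℝ}
    (hM : ∀ᵐ v ∂ρ, ∀ i, |d i v| ≤ M) : Integrable (meanSq d) ρ := by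
  refine Integrable.of_bound (measurable_meanSq hd).aestronglyMeasurable (M ^ 2) ?_
  filter_upwards [hM] with v hv
  rw [Real.norm_of_nonneg (meanSq_nonneg _ _)]
  exact meanSq_le hn fun i => sq_le_sq' (abs_le.mp (hv i)).1 (abs_le.mp (hv i)).2

theorem integral_signedMean_eq_zero (hn : 1 ≤ n) {ρ : Measure ((Fin n → Fin 2) × V)}
    [IsFiniteMeasure ρ] {d : Fin n → V → ℝ} (hi : Integrable (meanSq d) ρ.snd)
    (h0 : ∫ v, meanSq d v ∂ρ.snd = 0) : ∫ p, signedMean d p ∂ρ = 0 := by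
  have h1 : ∀ᵐ v ∂ρ.snd, meanSq d v = 0 :=
    (integral_eq_zero_iff_of_nonneg (f := meanSq d) (meanSq_nonneg d) hi).mp h0
  have h2 : ∀ᵐ p ∂ρ, meanSq d p.2 = 0 := ae_of_ae_map measurable_snd.aemeasurable h1
  refine integral_eq_zero_of_ae ?_
  filter_upwards [h2] with p hp using signedMean_eq_zero_of_meanSq hn hp p.1

theorem integral_signedMean_le_klDiv (hn : 1 ≤ n) (κ : Kernel (Fin n → Fin 2) V)
    [IsMarkovKernel κ] {d : Fin n → V → ℝ} (hd : ∀ i, Measurable (d i)) {M : ℝ}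
    (hM : ∀ᵐ v ∂(bitsLaw n ⊗ₘ κ).snd, ∀ i, |d i v| ≤ M)
    (hK : klDiv (bitsLaw n ⊗ₘ κ) ((bitsLaw n ⊗ₘ κ).fst.prod (bitsLaw n ⊗ₘ κ).snd) ≠ ∞) (t : ℝ) :
    t * ∫ p, signedMean d p ∂(bitsLaw n ⊗ₘ κ) -
      t ^ 2 / (2 * n) * ∫ v, meanSq d v ∂(bitsLaw n ⊗ₘ κ).snd ≤
    (klDiv (bitsLaw n ⊗ₘ κ)
      ((bitsLaw n ⊗ₘ κ).fst.prod (bitsLaw n ⊗ₘ κ).snd)).toReal := by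
  have hfst : (bitsLaw n ⊗ₘ κ).fst = bitsLaw n := Measure.fst_compProd _ _
  have hfi : Integrable (signedMean d) (bitsLaw n ⊗ₘ κ) :=
    integrable_signedMean hn hd (ae_of_ae_map measurable_snd.aemeasurable hM)
  have hsi : Integrable (fun p : (Fin n → Fin 2) × V => meanSq d p.2) (bitsLaw n ⊗ₘ κ) :=
    (integrable_meanSq hn hd hM).comp_measurable measurable_snd
  have hsint : ∫ p, meanSq d p.2 ∂(bitsLaw n ⊗ₘ κ) = ∫ v, meanSq d v ∂(bitsLaw n ⊗ₘ κ).snd :=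
    (integral_map measurable_snd.aemeasurable (measurable_meanSq hd).aestronglyMeasurable).symm
  have hg : Measurable fun p : (Fin n → Fin 2) × V =>
      t * signedMean d p - t ^ 2 / (2 * n) * meanSq d p.2 :=
    ((measurable_signedMean hd).const_mul _).sub
      (((measurable_meanSq hd).comp measurable_snd).const_mul _)
  have h := ofReal_integral_le_klDiv hg
    ((hfi.const_mul t).sub (hsi.const_mul _)) (lintegral_exp_signedMean_le hd (bitsLaw n ⊗ₘ κ).snd t)
  rw [hfst] at hK ⊢
  rwa [integral_sub (hfi.const_mul t) (hsi.const_mul _), integral_const_mul,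
    integral_const_mul, hsint, ENNReal.ofReal_le_iff_le_toReal hK] at h

/-- Bounding a mean signed difference by mutual information, for a fixed super-sample. -/
theorem ofReal_integral_signedMean_le (hn : 1 ≤ n) (κ : Kernel (Fin n → Fin 2) V)
    [IsMarkovKernel κ] {d : Fin n → V → ℝ} (hd : ∀ i, Measurable (d i)) {M : ℝ}
    (hM : ∀ᵐ v ∂(bitsLaw n ⊗ₘ κ).snd, ∀ i, |d i v| ≤ M) :
    ENNReal.ofReal (∫ p, signedMean d p ∂(bitsLaw n ⊗ₘ κ)) ≤
      (ENNReal.ofReal (2 / (n : ℝ)) * (∫⁻ v, ENNReal.ofReal (meanSq d v) ∂(bitsLaw n ⊗ₘ κ).snd) *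
        klDiv (bitsLaw n ⊗ₘ κ) ((bitsLaw n ⊗ₘ κ).fst.prod (bitsLaw n ⊗ₘ κ).snd)) ^
          (1 / 2 : ℝ) := by
  have hn' : (0 : ℝ) < n := by exact_mod_cast hn
  have hquad := integral_signedMean_le_klDiv hn κ hd hM
  have hsi := integrable_meanSq hn hd hM
  have hzero := integral_signedMean_eq_zero hn hsi
  rw [← ofReal_integral_eq_lintegral_ofReal hsi (Filter.Eventually.of_forall (meanSq_nonneg d))]
  have hs0 : 0 ≤ ∫ v, meanSq d v ∂(bitsLaw n ⊗ₘ κ).snd := integral_nonneg (meanSq_nonneg d)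
  generalize ∫ p, signedMean d p ∂(bitsLaw n ⊗ₘ κ) = a at *
  generalize ∫ v, meanSq d v ∂(bitsLaw n ⊗ₘ κ).snd = s at *
  generalize klDiv (bitsLaw n ⊗ₘ κ)
    ((bitsLaw n ⊗ₘ κ).fst.prod (bitsLaw n ⊗ₘ κ).snd) = K at *
  rcases le_or_gt a 0 with ha0 | ha0
  · rw [ENNReal.ofReal_of_nonpos ha0]; exact zero_le
  by_cases hK : K = ∞
  -- Infinite information makes the right side infinite unless the mean square `s` is zero, and `s =
  -- 0` would force `a = 0`.
  · have hspos : 0 < s := hs0.lt_of_ne fun h0 => ha0.ne' (hzero h0.symm)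
    rw [hK, ENNReal.mul_top, ENNReal.top_rpow_of_pos (by norm_num)]
    · exact le_top
    · have h2n : 0 < 2 / (n : ℝ) := by positivity
      exact (ENNReal.mul_pos (ENNReal.ofReal_pos.mpr h2n).ne' (ENNReal.ofReal_pos.mpr hspos).ne').ne'
  · have hK0 : 0 ≤ K.toReal := ENNReal.toReal_nonneg
    -- The inequality holds for every real `t`, so the discriminant condition performs the
    -- optimization: `a² ≤ 4 (s / 2n) K`.
    have hdisc := discrim_le_zero (a := s / (2 * n)) (b := -a) (c := K.toReal) fun t => by
      have e : s / (2 * n) * (t * t) = t ^ 2 / (2 * n) * s := by ring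
      have := hquad hK t
      rw [e]; linarith
    have h2 : a ^ 2 ≤ 2 / n * s * K.toReal := by
      rw [discrim] at hdisc
      have e : 4 * (s / (2 * n)) * K.toReal = 2 / n * s * K.toReal := by field_simp; ring
      linarith
    rw [← ENNReal.ofReal_toReal hK, ← ENNReal.ofReal_mul (by positivity),
      ← ENNReal.ofReal_mul (by positivity), ENNReal.ofReal_rpow_of_nonneg (by positivity)
      (by norm_num), ← Real.sqrt_eq_rpow]
    exact ENNReal.ofReal_le_ofReal (Real.le_sqrt_of_sq_le h2)

end Rademacher

/-- No integrability is required: the Bochner integral of a non-integrable function is `0`. This is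
what later permits exchanging the super-sample and an unbounded `Θ` by Tonelli alone. -/
theorem ofReal_integral_le_lintegral {α : Type*} [MeasurableSpace α] {ν : Measure α} (f : α → ℝ) :
    ENNReal.ofReal (∫ x, f x ∂ν) ≤ ∫⁻ x, ENNReal.ofReal (f x) ∂ν := by
  by_cases hf : Integrable f ν
  · rw [integral_eq_lintegral_pos_part_sub_lintegral_neg_part hf]
    refine (ENNReal.ofReal_le_ofReal (sub_le_self _ ENNReal.toReal_nonneg)).trans ?_
    exact ENNReal.ofReal_toReal_le
  · simp [integral_undef hf]

/-! ### Signed differences as ghost loss minus training loss. -/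

section PairDiff

variable {Z V : Type*} {n : ℕ}

/-- The complementary membership vector, selecting the ghost sample. -/
def flip (J : Fin n → Fin 2) : Fin n → Fin 2 := fun i => 1 - J i

/-- The loss differences of the pairs of a super-sample. -/
def pairDiff (h : Z → V → ℝ) (S : Fin n → Fin 2 → Z) (i : Fin n) (v : V) : ℝ :=
  h (S i 0) v - h (S i 1) v

theorem signedMean_pairDiff (h : Z → V → ℝ) (S : Fin n → Fin 2 → Z) (J : Fin n → Fin 2) (v : V) :
    signedMean (pairDiff h S) (J, v) =
      (1 / (n : ℝ)) * ∑ i, h (select S (flip J) i) v - (1 / (n : ℝ)) * ∑ i, h (select S J i) v := by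
  rw [← mul_sub, ← Finset.sum_sub_distrib, signedMean]
  congr 1
  refine Finset.sum_congr rfl fun i _ => ?_
  have : ∀ j : Fin 2, bitSign j * (h (S i 0) v - h (S i 1) v) = h (S i (1 - j)) v - h (S i j) v := by
    intro j
    fin_cases j <;> simp [bitSign]
  exact this (J i)

theorem abs_mean_le {h : Fin n → ℝ} {M : ℝ} (hn : 1 ≤ n) (hM : ∀ i, |h i| ≤ M) :
    |(1 / (n : ℝ)) * ∑ i, h i| ≤ M := by
  have hn' : (0 : ℝ) < n := by exact_mod_cast hn
  rw [abs_mul, abs_of_pos (by positivity), one_div, inv_mul_le_iff₀ hn']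
  refine (Finset.abs_sum_le_sum_abs _ _).trans ?_
  exact (Finset.sum_le_sum (g := fun _ => M) fun i _ => hM i).trans (by simp)

end PairDiff

/-! ### Symmetrization with a ghost sample. -/

section Supersample

variable {Z : Type*} [MeasurableSpace Z] {n : ℕ} (μ : Measure Z) [IsProbabilityMeasure μ]

instance : IsProbabilityMeasure (sampleLaw μ n) := by unfold sampleLaw; infer_instance

instance : IsProbabilityMeasure (superLaw μ n) := by unfold superLaw; infer_instance

theorem measurable_select (J : Fin n → Fin 2) :
    Measurable fun S : Fin n → Fin 2 → Z => select S J := by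
  unfold select; fun_prop

/-- The training set and the ghost sample are independent i.i.d. samples. -/
theorem measurePreserving_select_flip (J : Fin n → Fin 2) :
    MeasurePreserving (fun S : Fin n → Fin 2 → Z => (select S J, select S (flip J)))
      (superLaw μ n) ((sampleLaw μ n).prod (sampleLaw μ n)) := by
  -- Within one pair, the choice of the bit only swaps two i.i.d. coordinates.
  have hpair : ∀ j : Fin 2, (Measure.pi fun _ : Fin 2 => μ).map (fun x => (x j, x (1 - j))) =
      μ.prod μ := by
    have h0 := (measurePreserving_piFinTwo (fun _ : Fin 2 => μ)).map_eq
    have h0' : (Measure.pi fun _ : Fin 2 => μ).map (fun x => (x 0, x 1)) = μ.prod μ := h0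
    intro j
    fin_cases j
    · exact h0'
    · have h1 := congrArg (Measure.map Prod.swap) h0'
      rw [Measure.prod_swap, Measure.map_map measurable_swap (by fun_prop)] at h1
      exact h1
  have h1 : MeasurePreserving (fun (S : Fin n → Fin 2 → Z) i => (S i (J i), S i (1 - J i)))
      (superLaw μ n) (Measure.pi fun _ : Fin n => μ.prod μ) := by
    refine ⟨by fun_prop, ?_⟩
    have : ∀ i : Fin n, SigmaFinite ((Measure.pi fun _ : Fin 2 => μ).map
        (fun x => (x (J i), x (1 - J i)))) := by
      intro i; rw [hpair]; infer_instance
    rw [superLaw, Measure.pi_map_pi (μ := fun _ : Fin n => Measure.pi fun _ : Fin 2 => μ)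
      (f := fun i x => (x (J i), x (1 - J i))) (fun i => by fun_prop)]
    simp_rw [hpair]
  exact (measurePreserving_arrowProdEquivProdArrow Z Z (Fin n) (fun _ => μ) (fun _ => μ)).comp h1

variable {V : Type*} [MeasurableSpace V]

/-- For a bounded loss, the generalization error is the mean signed loss difference on a
super-sample. -/
theorem integral_gap_eq_integral_signedMean (hn : 1 ≤ n) (κ : Kernel (Fin n → Z) V)
    [IsMarkovKernel κ] {h : Z → V → ℝ} (hh : Measurable (Function.uncurry h)) {M : ℝ}
    (hM : ∀ z v, |h z v| ≤ M) :
    ∫ s, ∫ v, ((∫ z, h z v ∂μ) - (1 / (n : ℝ)) * ∑ i, h (s i) v) ∂(κ s) ∂(sampleLaw μ n) =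
      ∫ S, ∫ p, signedMean (pairDiff h S) p
        ∂(bitsLaw n ⊗ₘ κ.comap (select S) Measurable.of_discrete) ∂(superLaw μ n) := by
  have hdM : ∀ (S : Fin n → Fin 2 → Z) i v, |pairDiff h S i v| ≤ M + M := fun S i v =>
    (abs_sub _ _).trans (add_le_add (hM _ _) (hM _ _))
  have hdm : ∀ (S : Fin n → Fin 2 → Z) i, Measurable (pairDiff h S i) := fun S i => by
    unfold pairDiff
    exact (hh.comp (by fun_prop : Measurable fun v => (S i 0, v))).sub
      (hh.comp (by fun_prop : Measurable fun v => (S i 1, v)))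
  have hmean : Measurable fun q : (Fin n → Z) × V => (1 / (n : ℝ)) * ∑ i, h (q.1 i) q.2 := by
    refine (Finset.measurable_sum _ fun i _ => ?_).const_mul _
    exact hh.comp (by fun_prop : Measurable fun q : (Fin n → Z) × V => (q.1 i, q.2))
  let Φ : (Fin n → Z) × (Fin n → Z) → V → ℝ := fun q v =>
    (1 / (n : ℝ)) * ∑ i, h (q.2 i) v - (1 / (n : ℝ)) * ∑ i, h (q.1 i) v
  have hΦm : Measurable fun x : ((Fin n → Z) × (Fin n → Z)) × V => Φ x.1 x.2 :=
    (hmean.comp (by fun_prop : Measurable fun x : ((Fin n → Z) × (Fin n → Z)) × V => (x.1.2, x.2))).sub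
      (hmean.comp (by fun_prop : Measurable fun x : ((Fin n → Z) × (Fin n → Z)) × V => (x.1.1, x.2)))
  have hΦM : ∀ q v, |Φ q v| ≤ M + M := fun q v =>
    (abs_sub _ _).trans (add_le_add (abs_mean_le hn fun i => hM _ _) (abs_mean_le hn fun i => hM _ _))
  -- The model is drawn from the first sample only; the second is the ghost.
  let G : (Fin n → Z) × (Fin n → Z) → ℝ := fun q => ∫ v, Φ q v ∂(κ q.1)
  have hGm : StronglyMeasurable G :=
    hΦm.stronglyMeasurable.integral_kernel_prod_right'
      (κ := κ.comap (Prod.fst : (Fin n → Z) × (Fin n → Z) → _) measurable_fst)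
  have hGM : ∀ q, ‖G q‖ ≤ M + M := fun q => by
    refine (norm_integral_le_of_norm_le_const (C := M + M)
      (Filter.Eventually.of_forall fun v => hΦM q v)).trans (by simp)
  have hinner : ∀ S : Fin n → Fin 2 → Z,
      ∫ p, signedMean (pairDiff h S) p ∂(bitsLaw n ⊗ₘ κ.comap (select S) Measurable.of_discrete) =
        ∫ J, G (select S J, select S (flip J)) ∂(bitsLaw n) := by
    intro S
    rw [Measure.integral_compProd (integrable_signedMean hn (hdm S)
      (Filter.Eventually.of_forall fun p i => hdM S i p.2))]
    simp only [signedMean_pairDiff, Kernel.comap_apply, G, Φ]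
  simp_rw [hinner]
  have hswap : ∫ S, ∫ J, G (select S J, select S (flip J)) ∂(bitsLaw n) ∂(superLaw μ n) =
      ∫ J, ∫ S, G (select S J, select S (flip J)) ∂(superLaw μ n) ∂(bitsLaw n) := by
    refine integral_integral_swap ?_
    refine Integrable.of_bound (C := M + M) (Measurable.aestronglyMeasurable ?_)
      (Filter.Eventually.of_forall fun x => hGM _)
    refine measurable_from_prod_countable_left fun J => ?_
    exact hGm.measurable.comp (measurePreserving_select_flip μ J).measurable
  rw [hswap]
  -- For fixed `J` the training and ghost samples are i.i.d. whatever `J` is, so the average over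
  -- `J` becomes trivial.
  have hJ : ∀ J : Fin n → Fin 2, ∫ S, G (select S J, select S (flip J)) ∂(superLaw μ n) =
      ∫ s, ∫ s', G (s, s') ∂(sampleLaw μ n) ∂(sampleLaw μ n) := by
    intro J
    have e := integral_map (μ := superLaw μ n) (f := G) (measurePreserving_select_flip μ J).measurable.aemeasurable
      hGm.aestronglyMeasurable
    rw [(measurePreserving_select_flip μ J).map_eq] at e
    rw [← e, integral_prod _ (Integrable.of_bound hGm.aestronglyMeasurable _
      (Filter.Eventually.of_forall hGM))]
  simp_rw [hJ]
  rw [integral_const, probReal_univ, one_smul]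
  refine integral_congr_ae (Filter.Eventually.of_forall fun s => ?_)
  -- The ghost sample is independent of the model, so integrating it first turns its empirical mean
  -- into the population risk.
  have hsw : ∫ s', G (s, s') ∂(sampleLaw μ n) =
      ∫ v, ∫ s', Φ (s, s') v ∂(sampleLaw μ n) ∂(κ s) := by
    change ∫ s', ∫ v, Φ (s, s') v ∂(κ s) ∂(sampleLaw μ n) = _
    refine integral_integral_swap (f := fun s' v => Φ (s, s') v) ?_
    refine Integrable.of_bound (C := M + M) (Measurable.aestronglyMeasurable ?_)
      (Filter.Eventually.of_forall fun x => hΦM _ _)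
    exact hΦm.comp (by fun_prop : Measurable fun x : (Fin n → Z) × V => ((s, x.1), x.2))
  refine Eq.trans ?_ hsw.symm
  refine integral_congr_ae (Filter.Eventually.of_forall fun v => ?_)
  have hhv : Measurable fun z => h z v := hh.comp (by fun_prop : Measurable fun z => (z, v))
  have hi : ∀ i : Fin n, Integrable (fun s' : Fin n → Z => h (s' i) v) (sampleLaw μ n) := fun i =>
    Integrable.of_bound (C := M) (hhv.comp (measurable_pi_apply i)).aestronglyMeasurable
      (Filter.Eventually.of_forall fun x => hM _ _)
  have hn' : (n : ℝ) ≠ 0 := by positivity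
  simp only [Φ]
  rw [integral_sub ((integrable_finsetSum _ fun i _ => hi i).const_mul _) (integrable_const _),
    integral_const_mul, integral_finsetSum _ fun i _ => hi i, integral_const, probReal_univ,
    one_smul]
  have he : ∀ i : Fin n, ∫ s' : Fin n → Z, h (s' i) v ∂(sampleLaw μ n) = ∫ z, h z v ∂μ := fun i =>
    integral_comp_eval (μ := fun _ : Fin n => μ) (i := i) (f := fun z => h z v)
      hhv.aestronglyMeasurable
  simp [he, hn']

end Supersample

/-! ### The compressed algorithm as a kernel. -/

section Compressed

variable {Z : Type*} [MeasurableSpace Z] {D d n : ℕ} {𝒲 : Set (Vec D)}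

theorem measurable_unproj :
    Measurable (fun p : ProjMat D d × Vec d => unproj p.1 p.2) := by
  unfold unproj
  fun_prop

theorem continuous_unproj (Θ : ProjMat D d) : Continuous (unproj Θ) := by
  unfold unproj
  fun_prop

theorem measurable_proj_coe (Θ : ProjMat D d) : Measurable fun w : 𝒲 => proj Θ (w : Vec D) :=
  measurable_proj.comp (measurable_const.prodMk measurable_subtype_coe)

instance (A : Kernel (Fin n → Z) 𝒲) [IsMarkovKernel A] (Q : Kernel (Vec d) (Vec d))
    [IsMarkovKernel Q] (Θ : ProjMat D d) : IsMarkovKernel (compressed A Q Θ) := by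
  have := Kernel.IsMarkovKernel.map A (measurable_proj_coe (𝒲 := 𝒲) Θ)
  unfold compressed
  infer_instance

instance (A : Kernel (Fin n → Z) 𝒲) [IsMarkovKernel A] (Q : Kernel (Vec d) (Vec d))
    [IsMarkovKernel Q] (S : Fin n → Fin 2 → Z) (Θ : ProjMat D d) :
    IsProbabilityMeasure (bitsModelLaw A Q S Θ) := by
  unfold bitsModelLaw
  infer_instance

/-- The compressed algorithm as a kernel of the dataset and the projection matrix. -/
def jointCompressed (A : Kernel (Fin n → Z) 𝒲) (Q : Kernel (Vec d) (Vec d)) :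
    Kernel ((Fin n → Z) × ProjMat D d) (Vec d) :=
  Q ∘ₖ ((A.comap Prod.fst measurable_fst ×ₖ Kernel.deterministic Prod.snd measurable_snd).map
    (fun p : 𝒲 × ProjMat D d => proj p.2 (p.1 : Vec D)))

/-- `compressed` is a kernel only for frozen `Θ`; this identification supplies joint measurability
in the dataset and `Θ`. -/
theorem jointCompressed_apply (A : Kernel (Fin n → Z) 𝒲) [IsMarkovKernel A]
    (Q : Kernel (Vec d) (Vec d)) (s : Fin n → Z) (Θ : ProjMat D d) :
    jointCompressed A Q (s, Θ) = compressed A Q Θ s := by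
  have hm : Measurable fun p : 𝒲 × ProjMat D d => proj p.2 (p.1 : Vec D) :=
    measurable_proj.comp (measurable_snd.prodMk (measurable_subtype_coe.comp measurable_fst))
  rw [jointCompressed, compressed, Kernel.comp_apply, Kernel.comp_apply, Kernel.map_apply _ hm,
    Kernel.map_apply _ (measurable_proj_coe Θ), Kernel.prod_apply, Kernel.comap_apply,
    Kernel.deterministic_apply, Measure.prod_dirac, Measure.map_map hm (by fun_prop)]
  rfl

instance (A : Kernel (Fin n → Z) 𝒲) [IsMarkovKernel A] (Q : Kernel (Vec d) (Vec d))
    [IsMarkovKernel Q] : IsMarkovKernel (jointCompressed (D := D) A Q) := by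
  refine ⟨fun x => ?_⟩
  rw [show x = (x.1, x.2) from rfl, jointCompressed_apply]
  infer_instance

theorem integral_compressed (A : Kernel (Fin n → Z) 𝒲) [IsMarkovKernel A]
    (Q : Kernel (Vec d) (Vec d)) [IsMarkovKernel Q] (Θ : ProjMat D d) (s : Fin n → Z)
    {f : Vec d → ℝ} (hf : Measurable f) {M : ℝ} (hM : ∀ v, |f v| ≤ M) :
    ∫ v, f v ∂(compressed A Q Θ s) = ∫ w, ∫ v, f v ∂(Q (proj Θ (w : Vec D))) ∂(A s) := by
  have hi : Integrable f ((Q ∘ₖ (A.map (fun w : 𝒲 => proj Θ (w : Vec D)))) s) := by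
    have : IsProbabilityMeasure ((Q ∘ₖ (A.map (fun w : 𝒲 => proj Θ (w : Vec D)))) s) :=
      inferInstanceAs (IsProbabilityMeasure (compressed A Q Θ s))
    exact Integrable.of_bound hf.aestronglyMeasurable M (Filter.Eventually.of_forall hM)
  rw [compressed, Kernel.integral_comp hi, Kernel.map_apply _ (measurable_proj_coe Θ),
    integral_map (measurable_proj_coe Θ).aemeasurable]
  exact (hf.stronglyMeasurable.comp_measurable
    measurable_snd).integral_kernel_prod_right'.aestronglyMeasurable

end Compressed

/-! ### The loss truncated to a ball. -/

section Gap

variable {Z : Type*} {D d n : ℕ}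

/-- The loss of the lifted compressed model, set to zero outside the ball of radius `r`. -/
def liftedLoss (ℓ : Z → Vec D → ℝ) (r : ℝ) (Θ : ProjMat D d) (z : Z) (v : Vec d) : ℝ :=
  (Metric.closedBall (0 : Vec d) r).indicator (fun v => ℓ z (unproj Θ v)) v

theorem liftedLoss_of_mem (ℓ : Z → Vec D → ℝ) {r : ℝ} (Θ : ProjMat D d) (z : Z) {v : Vec d}
    (hv : v ∈ Metric.closedBall (0 : Vec d) r) : liftedLoss ℓ r Θ z v = ℓ z (unproj Θ v) := by
  simp [liftedLoss, Set.indicator_of_mem hv]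

/-- Truncation gives a globally bounded loss, so Fubini is available for each `Θ`, and it changes
nothing almost surely when `Ŵ` stays in the ball. The bound `M` depends on `Θ` and need not be
uniform over random matrices. -/
theorem exists_abs_liftedLoss_le {ℓ : Z → Vec D → ℝ} {L : ℝ} (hL : ∀ z w, |ℓ z w| ≤ L * ‖w‖)
    (r : ℝ) (Θ : ProjMat D d) : ∃ M, ∀ z v, |liftedLoss ℓ r Θ z v| ≤ M := by
  obtain ⟨C, hC⟩ := (isCompact_closedBall (0 : Vec d) r).exists_bound_of_continuousOn
    (continuous_unproj Θ).continuousOn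
  refine ⟨|L| * |C|, fun z v => ?_⟩
  by_cases hv : v ∈ Metric.closedBall (0 : Vec d) r
  · rw [liftedLoss_of_mem ℓ Θ z hv]
    refine (hL _ _).trans ?_
    exact mul_le_mul (le_abs_self _) ((hC v hv).trans (le_abs_self _)) (norm_nonneg _) (abs_nonneg _)
  · simp only [liftedLoss, Set.indicator_of_notMem hv, abs_zero]
    positivity

variable [MeasurableSpace Z]

theorem measurable_liftedLoss {ℓ : Z → Vec D → ℝ} (hℓ : Measurable (Function.uncurry ℓ)) (r : ℝ)
    {X : Type*} [MeasurableSpace X] {Θ : X → ProjMat D d} {z : X → Z} {v : X → Vec d}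
    (hΘ : Measurable Θ) (hz : Measurable z) (hv : Measurable v) :
    Measurable fun x => liftedLoss ℓ r (Θ x) (z x) (v x) := by
  have h1 : Measurable fun x => ℓ (z x) (unproj (Θ x) (v x)) :=
    hℓ.comp (hz.prodMk (measurable_unproj.comp (hΘ.prodMk hv)))
  exact h1.indicator (hv Metric.isClosed_closedBall.measurableSet)

end Gap

theorem abs_pairDiff_le {Z V : Type*} {n : ℕ} {h : Z → V → ℝ} {M : ℝ} (hM : ∀ z v, |h z v| ≤ M)
    (S : Fin n → Fin 2 → Z) (i : Fin n) (v : V) : |pairDiff h S i v| ≤ M + M :=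
  (abs_sub _ _).trans (add_le_add (hM _ _) (hM _ _))

/-! ### Generalization error and information at a fixed projection matrix. -/

section Bound

variable {Z : Type*} [MeasurableSpace Z] {D d n : ℕ} {𝒲 : Set (Vec D)}

/-- The generalization error of the lifted compressed model for the truncated loss. -/
def liftedGap (μ : Measure Z) (ℓ : Z → Vec D → ℝ) (r : ℝ) (Θ : ProjMat D d) (s : Fin n → Z)
    (v : Vec d) : ℝ :=
  (∫ z, liftedLoss ℓ r Θ z v ∂μ) - (1 / (n : ℝ)) * ∑ i, liftedLoss ℓ r Θ (s i) v

theorem liftedGap_of_mem (μ : Measure Z) (ℓ : Z → Vec D → ℝ) {r : ℝ} (Θ : ProjMat D d)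
    (s : Fin n → Z) {v : Vec d} (hv : v ∈ Metric.closedBall (0 : Vec d) r) :
    liftedGap μ ℓ r Θ s v = genErr μ ℓ s (unproj Θ v) := by
  simp only [liftedGap, genErr, popRisk, empRisk, liftedLoss_of_mem ℓ Θ _ hv]

theorem measurable_liftedGap (μ : Measure Z) [IsProbabilityMeasure μ] {ℓ : Z → Vec D → ℝ}
    (hℓ : Measurable (Function.uncurry ℓ)) (r : ℝ) {X : Type*} [MeasurableSpace X]
    {Θ : X → ProjMat D d} {s : X → Fin n → Z} {v : X → Vec d}
    (hΘ : Measurable Θ) (hs : Measurable s) (hv : Measurable v) :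
    Measurable fun x => liftedGap μ ℓ r (Θ x) (s x) (v x) := by
  have h0 : StronglyMeasurable fun y : X × Z => liftedLoss ℓ r (Θ y.1) y.2 (v y.1) :=
    (measurable_liftedLoss hℓ r (hΘ.comp measurable_fst) measurable_snd
      (hv.comp measurable_fst)).stronglyMeasurable
  have h1 : Measurable fun x => ∫ z, liftedLoss ℓ r (Θ x) z (v x) ∂μ :=
    (h0.integral_prod_right' (ν := μ)).measurable
  have h2 : ∀ i, Measurable fun x => liftedLoss ℓ r (Θ x) (s x i) (v x) := fun i =>
    measurable_liftedLoss hℓ r hΘ ((measurable_pi_apply i).comp hs) hv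
  exact h1.sub ((Finset.measurable_sum _ fun i _ => h2 i).const_mul _)

theorem abs_liftedGap_le (μ : Measure Z) [IsProbabilityMeasure μ] (hn : 1 ≤ n)
    {ℓ : Z → Vec D → ℝ} {r M : ℝ} {Θ : ProjMat D d} (hM : ∀ z v, |liftedLoss ℓ r Θ z v| ≤ M)
    (s : Fin n → Z) (v : Vec d) : |liftedGap μ ℓ r Θ s v| ≤ M + M := by
  refine (abs_sub _ _).trans (add_le_add ?_ (abs_mean_le hn fun i => hM _ _))
  have h := norm_integral_le_of_norm_le_const (μ := μ) (f := fun z => liftedLoss ℓ r Θ z v)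
    (Filter.Eventually.of_forall fun z => hM z v)
  simpa using h

/-- The mean signed loss difference for a given super-sample and projection matrix. -/
def meanSigned (ℓ : Z → Vec D → ℝ) (r : ℝ) (A : Kernel (Fin n → Z) 𝒲)
    (Q : Kernel (Vec d) (Vec d)) (S : Fin n → Fin 2 → Z) (Θ : ProjMat D d) : ℝ :=
  ∫ p, signedMean (pairDiff (liftedLoss ℓ r Θ) S) p ∂(bitsModelLaw A Q S Θ)

theorem measurable_liftedLoss_right {ℓ : Z → Vec D → ℝ} (hℓ : Measurable (Function.uncurry ℓ))
    (r : ℝ) (Θ : ProjMat D d) : Measurable (Function.uncurry (liftedLoss ℓ r Θ)) :=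
  measurable_liftedLoss hℓ r measurable_const measurable_fst measurable_snd

theorem measurable_pairDiff {ℓ : Z → Vec D → ℝ} (hℓ : Measurable (Function.uncurry ℓ))
    (r : ℝ) (Θ : ProjMat D d) (S : Fin n → Fin 2 → Z) (i : Fin n) :
    Measurable (pairDiff (liftedLoss ℓ r Θ) S i) :=
  (measurable_liftedLoss hℓ r measurable_const measurable_const measurable_id).sub
    (measurable_liftedLoss hℓ r measurable_const measurable_const measurable_id)

theorem measurable_meanSigned (hn : 1 ≤ n) {ℓ : Z → Vec D → ℝ}
    (hℓ : Measurable (Function.uncurry ℓ))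
    {L : ℝ} (hL : ∀ z w, |ℓ z w| ≤ L * ‖w‖) (r : ℝ) (A : Kernel (Fin n → Z) 𝒲) [IsMarkovKernel A]
    (Q : Kernel (Vec d) (Vec d)) [IsMarkovKernel Q] :
    Measurable fun x : (Fin n → Fin 2 → Z) × ProjMat D d => meanSigned ℓ r A Q x.1 x.2 := by
  have hJ : ∀ J : Fin n → Fin 2, Measurable fun x : (Fin n → Fin 2 → Z) × ProjMat D d =>
      ∫ v, signedMean (pairDiff (liftedLoss ℓ r x.2) x.1) (J, v)
        ∂(jointCompressed A Q (select x.1 J, x.2)) := by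
    intro J
    have hm : Measurable fun y : ((Fin n → Fin 2 → Z) × ProjMat D d) × Vec d =>
        signedMean (pairDiff (liftedLoss ℓ r y.1.2) y.1.1) (J, y.2) := by
      have h : ∀ i j, Measurable fun y : ((Fin n → Fin 2 → Z) × ProjMat D d) × Vec d =>
          liftedLoss ℓ r y.1.2 (y.1.1 i j) y.2 := fun i j =>
        measurable_liftedLoss hℓ r (by fun_prop) (by fun_prop) (by fun_prop)
      have h' : ∀ i, Measurable fun y : ((Fin n → Fin 2 → Z) × ProjMat D d) × Vec d =>
          bitSign (J i) * pairDiff (liftedLoss ℓ r y.1.2) y.1.1 i y.2 := fun i =>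
        ((h i 0).sub (h i 1)).const_mul _
      exact (Finset.measurable_sum _ fun i _ => h' i).const_mul _
    have hsel : Measurable fun x : (Fin n → Fin 2 → Z) × ProjMat D d => (select x.1 J, x.2) :=
      ((measurable_select J).comp measurable_fst).prodMk measurable_snd
    exact (hm.stronglyMeasurable.integral_kernel_prod_right'
      (κ := (jointCompressed A Q).comap _ hsel)).measurable
  -- The bits take finitely many values, so the joint integral is a finite sum of kernel integrals,
  -- each measurable.
  have e : (fun x : (Fin n → Fin 2 → Z) × ProjMat D d => meanSigned ℓ r A Q x.1 x.2) =
      fun x => ∑ J, (bitsLaw n).real {J} * ∫ v, signedMean (pairDiff (liftedLoss ℓ r x.2) x.1) (J, v)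
        ∂(jointCompressed A Q (select x.1 J, x.2)) := by
    funext x
    obtain ⟨M, hM⟩ := exists_abs_liftedLoss_le hL r x.2
    rw [meanSigned, bitsModelLaw, Measure.integral_compProd (integrable_signedMean hn
      (measurable_pairDiff hℓ r x.2 x.1)
      (Filter.Eventually.of_forall fun p i => abs_pairDiff_le hM x.1 i p.2)),
      integral_fintype Integrable.of_finite]
    simp only [jointCompressed_apply, Kernel.comap_apply, smul_eq_mul]
  rw [e]
  exact Finset.measurable_sum _ fun J _ => (hJ J).const_mul _

theorem ofReal_meanSigned_le (hn : 1 ≤ n) {ℓ : Z → Vec D → ℝ}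
    (hℓ : Measurable (Function.uncurry ℓ)) {L : ℝ} (hL : ∀ z w, |ℓ z w| ≤ L * ‖w‖) (r : ℝ)
    (A : Kernel (Fin n → Z) 𝒲) [IsMarkovKernel A] (Q : Kernel (Vec d) (Vec d)) [IsMarkovKernel Q]
    (S : Fin n → Fin 2 → Z) (Θ : ProjMat D d) :
    ENNReal.ofReal (meanSigned ℓ r A Q S Θ) ≤
      (ENNReal.ofReal (2 / (n : ℝ)) * lossGap ℓ A Q S Θ * dcmi A Q S Θ) ^ (1 / 2 : ℝ) := by
  obtain ⟨M, hM⟩ := exists_abs_liftedLoss_le hL r Θ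
  refine (ofReal_integral_signedMean_le hn _ (measurable_pairDiff hℓ r Θ S)
    (Filter.Eventually.of_forall fun v i => abs_pairDiff_le hM S i v)).trans ?_
  refine ENNReal.rpow_le_rpow ?_ (by norm_num)
  refine mul_le_mul_left (mul_le_mul_right (lintegral_mono fun v => ?_) _) _
  refine ENNReal.ofReal_le_ofReal ?_
  unfold meanSq pairDiff
  refine mul_le_mul_of_nonneg_left (Finset.sum_le_sum fun i _ => ?_) (by positivity)
  -- Truncation can only decrease the squared differences, so the untruncated `lossGap` remains an
  -- upper bound.
  by_cases hv : v ∈ Metric.closedBall (0 : Vec d) r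
  · simp only [liftedLoss_of_mem ℓ Θ _ hv]; exact le_rfl
  · have h0 : ∀ z, liftedLoss ℓ r Θ z v = 0 := fun z => Set.indicator_of_notMem hv _
    rw [h0, h0, sub_zero, zero_pow two_ne_zero]
    exact sq_nonneg _

/-- With `Θ` frozen, the compressed algorithm is an ordinary learning algorithm with bounded loss,
to which symmetrization applies. -/
theorem integral_liftedGap_eq (μ : Measure Z) [IsProbabilityMeasure μ] (hn : 1 ≤ n)
    {ℓ : Z → Vec D → ℝ} (hℓ : Measurable (Function.uncurry ℓ)) {L : ℝ}
    (hL : ∀ z w, |ℓ z w| ≤ L * ‖w‖) (r : ℝ)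
    (A : Kernel (Fin n → Z) 𝒲) [IsMarkovKernel A] (Q : Kernel (Vec d) (Vec d)) [IsMarkovKernel Q]
    (Θ : ProjMat D d) :
    ∫ p, ∫ v, liftedGap μ ℓ r Θ p.1 v ∂(Q (proj Θ (p.2 : Vec D))) ∂(trainLaw μ A) =
      ∫ S, meanSigned ℓ r A Q S Θ ∂(superLaw μ n) := by
  obtain ⟨M, hM⟩ := exists_abs_liftedLoss_le hL r Θ
  have hproj : Measurable fun p : (Fin n → Z) × 𝒲 => proj Θ (p.2 : Vec D) :=
    (measurable_proj_coe Θ).comp measurable_snd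
  have hg : Measurable fun y : ((Fin n → Z) × 𝒲) × Vec d => liftedGap μ ℓ r Θ y.1.1 y.2 :=
    measurable_liftedGap μ hℓ r measurable_const (by fun_prop) measurable_snd
  have hm : StronglyMeasurable fun p : (Fin n → Z) × 𝒲 =>
      ∫ v, liftedGap μ ℓ r Θ p.1 v ∂(Q (proj Θ (p.2 : Vec D))) :=
    hg.stronglyMeasurable.integral_kernel_prod_right' (κ := Q.comap _ hproj)
  have hb : ∀ p : (Fin n → Z) × 𝒲,
      ‖∫ v, liftedGap μ ℓ r Θ p.1 v ∂(Q (proj Θ (p.2 : Vec D)))‖ ≤ M + M := fun p =>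
    (norm_integral_le_of_norm_le_const (C := M + M)
      (Filter.Eventually.of_forall fun v => abs_liftedGap_le μ hn hM p.1 v)).trans (by simp)
  rw [trainLaw, Measure.integral_compProd
    (Integrable.of_bound hm.aestronglyMeasurable _ (Filter.Eventually.of_forall hb))]
  have h := integral_gap_eq_integral_signedMean μ hn (compressed A Q Θ)
    (measurable_liftedLoss_right hℓ r Θ) hM
  refine Eq.trans ?_ h
  refine integral_congr_ae (Filter.Eventually.of_forall fun s => ?_)
  exact (integral_compressed A Q Θ s (f := liftedGap μ ℓ r Θ s)
    (measurable_liftedGap μ hℓ r measurable_const measurable_const measurable_id)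
    (abs_liftedGap_le μ hn hM s)).symm

end Bound

/-! ### The projection-compression bound for bounded quantization sets. -/

section CMI

variable {Z : Type*} [MeasurableSpace Z] {D d n : ℕ} {𝒲 : Set (Vec D)}

instance (μ : Measure Z) [IsProbabilityMeasure μ] (A : Kernel (Fin n → Z) 𝒲) [IsMarkovKernel A] :
    IsProbabilityMeasure (trainLaw μ A) := by
  unfold trainLaw; infer_instance

instance (μ : Measure Z) [IsProbabilityMeasure μ] (A : Kernel (Fin n → Z) 𝒲) [IsMarkovKernel A]
    (P : Measure (ProjMat D d)) [IsProbabilityMeasure P] (Q : Kernel (Vec d) (Vec d))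
    [IsMarkovKernel Q] : IsProbabilityMeasure (fullLaw μ A P Q) := by
  unfold fullLaw; infer_instance

theorem fst_fullLaw (μ : Measure Z) [IsProbabilityMeasure μ] (A : Kernel (Fin n → Z) 𝒲)
    [IsMarkovKernel A] (P : Measure (ProjMat D d)) [IsProbabilityMeasure P]
    (Q : Kernel (Vec d) (Vec d)) [IsMarkovKernel Q] :
    (fullLaw μ A P Q).fst = (trainLaw μ A).prod P := by
  unfold fullLaw; exact Measure.fst_compProd _ _

theorem measurePreserving_train (μ : Measure Z) [IsProbabilityMeasure μ]
    (A : Kernel (Fin n → Z) 𝒲) [IsMarkovKernel A] (P : Measure (ProjMat D d))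
    [IsProbabilityMeasure P] (Q : Kernel (Vec d) (Vec d)) [IsMarkovKernel Q] :
    MeasurePreserving (fun p => p.1.1) (fullLaw μ A P Q) (trainLaw μ A) :=
  MeasurePreserving.comp (measurePreserving_fst (μ := trainLaw μ A) (ν := P))
    ⟨measurable_fst, fst_fullLaw μ A P Q⟩

/-- Almost sure properties of the compressed model, uniform in its input. -/
theorem ae_fullLaw_of_forall (μ : Measure Z) [IsProbabilityMeasure μ]
    (A : Kernel (Fin n → Z) 𝒲) [IsMarkovKernel A] (P : Measure (ProjMat D d))
    [IsProbabilityMeasure P] (Q : Kernel (Vec d) (Vec d)) [IsMarkovKernel Q]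
    {s : Set (Vec d)} (hs : MeasurableSet s) (h : ∀ x, ∀ᵐ v ∂(Q x), v ∈ s) :
    ∀ᵐ p ∂(fullLaw μ A P Q), p.2 ∈ s := by
  unfold fullLaw
  rw [Measure.ae_compProd_iff (measurable_snd hs)]
  exact Filter.Eventually.of_forall fun x => h _

/-- The mean generalization error of the lifted compressed model, conditionally on the
projection. -/
theorem integral_liftedGap_fullLaw (μ : Measure Z) [IsProbabilityMeasure μ] (hn : 1 ≤ n)
    {ℓ : Z → Vec D → ℝ} (hℓ : Measurable (Function.uncurry ℓ)) {L : ℝ}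
    (hL : ∀ z w, |ℓ z w| ≤ L * ‖w‖) (r : ℝ)
    (A : Kernel (Fin n → Z) 𝒲) [IsMarkovKernel A] (P : Measure (ProjMat D d))
    [IsProbabilityMeasure P] (Q : Kernel (Vec d) (Vec d)) [IsMarkovKernel Q]
    (hi : Integrable (fun p => liftedGap μ ℓ r p.1.2 p.1.1.1 p.2) (fullLaw μ A P Q)) :
    ∫ p, liftedGap μ ℓ r p.1.2 p.1.1.1 p.2 ∂(fullLaw μ A P Q) =
      ∫ Θ, ∫ S, meanSigned ℓ r A Q S Θ ∂(superLaw μ n) ∂P := by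
  unfold fullLaw at hi ⊢
  rw [Measure.integral_compProd hi, integral_prod_symm]
  · refine integral_congr_ae (Filter.Eventually.of_forall fun Θ => ?_)
    exact integral_liftedGap_eq μ hn hℓ hL r A Q Θ
  · exact Integrable.integral_compProd (κ := Kernel.const Unit ((trainLaw μ A).prod P)) (a := ())
      (η := Kernel.prodMkLeft Unit _) hi

/-- The projection and compression bound for a bounded quantization set: the difference between
the expected generalization error and the distortion level is at most `cmiTerm`. -/
theorem ofReal_expGenErr_sub_le_cmiTerm (μ : Measure Z) [IsProbabilityMeasure μ] (hn : 1 ≤ n)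
    {ℓ : Z → Vec D → ℝ} (hℓ : Measurable (Function.uncurry ℓ)) {L : ℝ}
    (hL : ∀ z w, |ℓ z w| ≤ L * ‖w‖) (A : Kernel (Fin n → Z) 𝒲) [IsMarkovKernel A]
    (hgen : Integrable (fun p => genErr μ ℓ p.1 (p.2 : Vec D)) (trainLaw μ A))
    {r : ℝ} {What : Set (Vec d)} (hW : What ⊆ Metric.closedBall 0 r) {τ : ℝ}
    {P : Measure (ProjMat D d)} {Q : Kernel (Vec d) (Vec d)}
    (h : IsAdmissible μ ℓ A What τ P Q) :
    ENNReal.ofReal (expGenErr μ ℓ A - τ) ≤ cmiTerm μ ℓ A P Q := by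
  have := h.isProbabilityMeasure
  have := h.isMarkovKernel
  have hmp := measurePreserving_train μ A P Q
  have h1 : Integrable (fun p => genErr μ ℓ p.1.1.1 (p.1.1.2 : Vec D)) (fullLaw μ A P Q) :=
    hmp.integrable_comp_of_integrable hgen
  have e1 : ∫ p, genErr μ ℓ p.1.1.1 (p.1.1.2 : Vec D) ∂(fullLaw μ A P Q) = expGenErr μ ℓ A := by
    rw [expGenErr, ← hmp.map_eq, integral_map hmp.measurable.aemeasurable]
    rw [hmp.map_eq]; exact hgen.aestronglyMeasurable
  -- Admissibility gives integrability of the difference only; that of the compressed term follows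
  -- by subtracting it from `h1`.
  have h2 : Integrable (fun p => genErr μ ℓ p.1.1.1 (unproj p.1.2 p.2)) (fullLaw μ A P Q) := by
    refine (h1.sub h.integrable).congr (Filter.Eventually.of_forall fun p => ?_)
    simp
  have e2 : expGenErr μ ℓ A - τ ≤
      ∫ p, genErr μ ℓ p.1.1.1 (unproj p.1.2 p.2) ∂(fullLaw μ A P Q) := by
    have := h.distortion_le
    rw [integral_sub h1 h2, e1] at this
    linarith
  have hae : (fun p => genErr μ ℓ p.1.1.1 (unproj p.1.2 p.2)) =ᵐ[fullLaw μ A P Q]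
      fun p => liftedGap μ ℓ r p.1.2 p.1.1.1 p.2 := by
    filter_upwards [ae_fullLaw_of_forall μ A P Q Metric.isClosed_closedBall.measurableSet
      fun x => (h.mem_What x).mono fun v hv => hW hv] with p hp
    exact (liftedGap_of_mem μ ℓ p.1.2 p.1.1.1 hp).symm
  rw [integral_congr_ae hae,
    integral_liftedGap_fullLaw μ hn hℓ hL r A P Q (h2.congr hae)] at e2
  have hmeas := measurable_meanSigned hn hℓ hL r A Q
  calc ENNReal.ofReal (expGenErr μ ℓ A - τ)
      ≤ ENNReal.ofReal (∫ Θ, ∫ S, meanSigned ℓ r A Q S Θ ∂(superLaw μ n) ∂P) :=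
        ENNReal.ofReal_le_ofReal e2
    _ ≤ ∫⁻ Θ, ∫⁻ S, ENNReal.ofReal (meanSigned ℓ r A Q S Θ) ∂(superLaw μ n) ∂P :=
        (ofReal_integral_le_lintegral _).trans
          (lintegral_mono fun Θ => ofReal_integral_le_lintegral _)
    _ = ∫⁻ S, ∫⁻ Θ, ENNReal.ofReal (meanSigned ℓ r A Q S Θ) ∂P ∂(superLaw μ n) :=
        (lintegral_lintegral_swap hmeas.ennreal_ofReal.aemeasurable).symm
    _ ≤ cmiTerm μ ℓ A P Q :=
        lintegral_mono fun S => lintegral_mono fun Θ => ofReal_meanSigned_le hn hℓ hL r A Q S Θ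

theorem coe_le_coe_add_of_ofReal_sub_le {x τ : ℝ} {c : ℝ≥0∞} (h : ENNReal.ofReal (x - τ) ≤ c) :
    (x : EReal) ≤ (c : EReal) + (τ : EReal) := by
  have h1 : ((x - τ : ℝ) : EReal) ≤ (c : EReal) := by
    refine le_trans ?_ (EReal.coe_ennreal_le_coe_ennreal_iff.mpr h)
    rw [EReal.coe_ennreal_ofReal]
    exact EReal.coe_le_coe_iff.mpr (le_max_left _ _)
  calc (x : EReal) = ((x - τ : ℝ) : EReal) + (τ : EReal) := by
        rw [← EReal.coe_add, sub_add_cancel]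
    _ ≤ _ := by gcongr

/-- The projection and compression bound for a bounded quantization set. -/
theorem expGenErr_le_cmiBound (μ : Measure Z) [IsProbabilityMeasure μ] (hn : 1 ≤ n)
    {ℓ : Z → Vec D → ℝ} (hℓ : Measurable (Function.uncurry ℓ)) {L : ℝ}
    (hL : ∀ z w, |ℓ z w| ≤ L * ‖w‖) (A : Kernel (Fin n → Z) 𝒲) [IsMarkovKernel A]
    (hgen : Integrable (fun p => genErr μ ℓ p.1 (p.2 : Vec D)) (trainLaw μ A))
    {r : ℝ} {What : Set (Vec d)} (hW : What ⊆ Metric.closedBall 0 r) (τ : ℝ) :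
    (expGenErr μ ℓ A : EReal) ≤ cmiBound μ ℓ A What τ :=
  coe_le_coe_add_of_ofReal_sub_le <| le_iInf fun _ => le_iInf fun _ => le_iInf fun h =>
    ofReal_expGenErr_sub_le_cmiTerm μ hn hℓ hL A hgen hW h

theorem cmiBound_le (μ : Measure Z) {ℓ : Z → Vec D → ℝ} (A : Kernel (Fin n → Z) 𝒲)
    {What : Set (Vec d)} {τ : ℝ} {P : Measure (ProjMat D d)} {Q : Kernel (Vec d) (Vec d)}
    (h : IsAdmissible μ ℓ A What τ P Q) :
    cmiBound μ ℓ A What τ ≤ (cmiTerm μ ℓ A P Q : EReal) + (τ : EReal) := by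
  have hle : ⨅ (P : Measure (ProjMat D d)) (Q : Kernel (Vec d) (Vec d))
      (_ : IsAdmissible μ ℓ A What τ P Q), cmiTerm μ ℓ A P Q ≤ cmiTerm μ ℓ A P Q :=
    iInf_le_of_le P (iInf_le_of_le Q (iInf_le _ h))
  exact add_le_add (EReal.coe_ennreal_le_coe_ennreal_iff.mpr hle) le_rfl

end CMI

/-! ### Second moment tools. -/

section Moments

/-- Jensen's inequality, in the form of nonnegativity of the variance. -/
theorem integral_le_sqrt_of_integral_sq_le {Ω : Type*} [MeasurableSpace Ω] {P : Measure Ω}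
    [IsProbabilityMeasure P] {X : Ω → ℝ} (hX : MemLp X 2 P) {b : ℝ} (h : ∫ x, X x ^ 2 ∂P ≤ b) :
    ∫ x, X x ∂P ≤ Real.sqrt b := by
  have h1 := variance_eq_sub hX
  have h2 := variance_nonneg X P
  have h3 : ∫ x, (X ^ 2) x ∂P = ∫ x, X x ^ 2 ∂P := rfl
  exact Real.le_sqrt_of_sq_le (by linarith)

/-- Orthogonality of independent centered square integrable variables. -/
theorem integral_sum_sq_pi {ι : Type*} [Fintype ι] {Ω : Type*} [MeasurableSpace Ω]
    {P : Measure Ω} [IsProbabilityMeasure P] {X : ι → Ω → ℝ} (hX : ∀ i, MemLp (X i) 2 P)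
    (h0 : ∀ i, ∫ x, X i x ∂P = 0) :
    ∫ ω, (∑ i, X i (ω i)) ^ 2 ∂(Measure.pi fun _ : ι => P) = ∑ i, ∫ x, X i x ^ 2 ∂P := by
  have h := variance_sum_pi (μ := fun _ : ι => P) hX
  have hm : ∀ i, MemLp (fun ω : ι → Ω => X i (ω i)) 2 (Measure.pi fun _ : ι => P) := fun i =>
    (hX i).comp_measurePreserving (measurePreserving_eval (fun _ : ι => P) i)
  have hsum : MemLp (∑ i, fun ω : ι → Ω => X i (ω i)) 2 (Measure.pi fun _ : ι => P) :=
    memLp_finsetSum' _ fun i _ => hm i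
  have hz : ∫ ω, (∑ i, fun ω : ι → Ω => X i (ω i)) ω ∂(Measure.pi fun _ : ι => P) = 0 := by
    simp only [Finset.sum_apply]
    rw [integral_finsetSum _ fun i _ => (hm i).integrable one_le_two]
    refine Finset.sum_eq_zero fun i _ => ?_
    rw [← h0 i]
    exact integral_comp_eval (μ := fun _ : ι => P) (f := X i) (hX i).aestronglyMeasurable
  rw [variance_of_integral_eq_zero hsum.aemeasurable hz] at h
  simp only [Finset.sum_apply] at h
  rw [h]
  exact Finset.sum_congr rfl fun i _ => variance_of_integral_eq_zero (hX i).aemeasurable (h0 i)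

end Moments

/-! ### One-column Gaussian projections. -/

section Gaussian

variable {D : ℕ}

/-- The inner product of the single column of `Θ` with `u`. -/
def colInner (Θ : ProjMat D 1) (u : Vec D) : ℝ := ∑ i, Θ i 0 * u i

theorem measurable_colInner : Measurable fun p : ProjMat D 1 × Vec D => colInner p.1 p.2 := by
  unfold colInner; fun_prop

/-- For `d = 1` the vector `Θ v` is a multiple of the single column, so every later estimate reduces
to a bound on `|v 0|` and a second moment of `colInner`. -/
theorem inner_unproj (Θ : ProjMat D 1) (v : Vec 1) (u : Vec D) :
    inner ℝ (unproj Θ v) u = v 0 * colInner Θ u := by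
  simp only [unproj, colInner, PiLp.inner_apply, Finset.mul_sum, Fin.sum_univ_one]
  refine Finset.sum_congr rfl fun i _ => ?_
  simp
  ring

instance (d : ℕ) : IsProbabilityMeasure (jlLaw D d) := by unfold jlLaw; infer_instance

theorem memLp_entry : MemLp (fun x : Fin 1 → ℝ => x 0) 2
    (Measure.pi fun _ : Fin 1 => gaussianReal 0 (1 / ((1 : ℕ) : ℝ≥0))) :=
  MemLp.comp_measurePreserving (g := id) (memLp_id_gaussianReal 2)
    (measurePreserving_eval (fun _ : Fin 1 => gaussianReal 0 (1 / ((1 : ℕ) : ℝ≥0))) 0)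

theorem integral_entry : ∫ x : Fin 1 → ℝ, x 0
    ∂(Measure.pi fun _ : Fin 1 => gaussianReal 0 (1 / ((1 : ℕ) : ℝ≥0))) = 0 := by
  refine (integral_comp_eval (μ := fun _ : Fin 1 => gaussianReal 0 (1 / ((1 : ℕ) : ℝ≥0)))
    (f := id) aestronglyMeasurable_id).trans ?_
  simp

theorem integral_entry_sq : ∫ x : Fin 1 → ℝ, x 0 ^ 2
    ∂(Measure.pi fun _ : Fin 1 => gaussianReal 0 (1 / ((1 : ℕ) : ℝ≥0))) = 1 := by
  refine (integral_comp_eval (μ := fun _ : Fin 1 => gaussianReal 0 (1 / ((1 : ℕ) : ℝ≥0)))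
    (f := fun x : ℝ => x ^ 2) (by fun_prop)).trans ?_
  have h := variance_of_integral_eq_zero (X := id) (μ := gaussianReal 0 (1 / ((1 : ℕ) : ℝ≥0)))
    aemeasurable_id (by simp)
  rw [variance_id_gaussianReal] at h
  simpa using h.symm

theorem memLp_eval_jlLaw (i : Fin D) : MemLp (fun Θ : ProjMat D 1 => Θ i 0) 2 (jlLaw D 1) :=
  memLp_entry.comp_measurePreserving (measurePreserving_eval _ i)

/-- Gaussian projections preserve squared norms in expectation. -/
theorem integral_colInner_sq (u : Vec D) : ∫ Θ, colInner Θ u ^ 2 ∂(jlLaw D 1) = ‖u‖ ^ 2 := by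
  have h := integral_sum_sq_pi (ι := Fin D) (X := fun i (x : Fin 1 → ℝ) => x 0 * u i)
    (fun i => memLp_entry.mul_const _) (fun i => by rw [integral_mul_const, integral_entry, zero_mul])
  rw [jlLaw]
  refine h.trans ?_
  rw [EuclideanSpace.norm_sq_eq]
  refine Finset.sum_congr rfl fun i _ => ?_
  simp_rw [mul_pow]
  rw [integral_mul_const, integral_entry_sq, one_mul, Real.norm_eq_abs, sq_abs]

theorem memLp_colInner (u : Vec D) : MemLp (fun Θ => colInner Θ u) 2 (jlLaw D 1) :=
  memLp_finsetSum _ fun i _ => (memLp_eval_jlLaw i).mul_const (u i)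

/-- A crude bound separating `u` from `Θ`. Its dimension dependence is harmless, as it serves only
to prove integrability. -/
theorem abs_colInner_le (Θ : ProjMat D 1) (u : Vec D) :
    |colInner Θ u| ≤ ‖u‖ * ∑ i, |Θ i 0| := by
  unfold colInner
  refine (Finset.abs_sum_le_sum_abs _ _).trans ?_
  rw [Finset.mul_sum]
  refine Finset.sum_le_sum fun i _ => ?_
  rw [abs_mul, mul_comm]
  exact mul_le_mul_of_nonneg_right (PiLp.norm_apply_le u i) (abs_nonneg _)

end Gaussian

/-! ### Linear losses and the deviation of the sample mean. -/

section LinearLoss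

variable {D n : ℕ} {𝒵 : Set (Vec D)}

theorem measurable_linLoss (L : ℝ) : Measurable (Function.uncurry (linLoss L 𝒵)) := by
  have : Measurable fun p : 𝒵 × Vec D => inner ℝ p.2 (p.1 : Vec D) :=
    (Continuous.inner continuous_snd (continuous_subtype_val.comp continuous_fst)).measurable
  exact this.const_mul (-L)

theorem norm_coe_le_one (h𝒵 : 𝒵 ⊆ Metric.closedBall 0 1) (z : 𝒵) : ‖(z : Vec D)‖ ≤ 1 := by
  simpa using h𝒵 z.2

theorem abs_linLoss_le {L : ℝ} (hL : 0 ≤ L) (h𝒵 : 𝒵 ⊆ Metric.closedBall 0 1) (z : 𝒵) (w : Vec D) :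
    |linLoss L 𝒵 z w| ≤ L * ‖w‖ := by
  rw [linLoss, abs_mul, abs_neg, abs_of_nonneg hL]
  refine mul_le_mul_of_nonneg_left ?_ hL
  refine (abs_real_inner_le_norm _ _).trans ?_
  exact mul_le_of_le_one_right (norm_nonneg _) (norm_coe_le_one h𝒵 z)

variable (μ : Measure 𝒵)

/-- The deviation of the sample mean from the mean. -/
def meanDev (s : Fin n → 𝒵) : Vec D :=
  (1 / (n : ℝ)) • ∑ i, (s i : Vec D) - ∫ z, (z : Vec D) ∂μ

theorem measurable_meanDev : Measurable (meanDev μ : (Fin n → 𝒵) → Vec D) := by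
  unfold meanDev
  have h : Measurable fun s : Fin n → 𝒵 => ∑ i, (s i : Vec D) :=
    Finset.measurable_sum _ fun i _ => measurable_subtype_coe.comp (measurable_pi_apply i)
  exact (h.const_smul (1 / (n : ℝ))).sub_const _

variable [IsProbabilityMeasure μ]

theorem integrable_coe (h𝒵 : 𝒵 ⊆ Metric.closedBall 0 1) :
    Integrable (fun z : 𝒵 => (z : Vec D)) μ :=
  Integrable.of_bound measurable_subtype_coe.aestronglyMeasurable 1
    (Filter.Eventually.of_forall (norm_coe_le_one h𝒵))

theorem genErr_linLoss (h𝒵 : 𝒵 ⊆ Metric.closedBall 0 1) (L : ℝ) (s : Fin n → 𝒵) (w : Vec D) :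
    genErr μ (linLoss L 𝒵) s w = L * inner ℝ w (meanDev μ s) := by
  have h : popRisk μ (linLoss L 𝒵) w = -L * inner ℝ w (∫ z, (z : Vec D) ∂μ) := by
    simp only [popRisk, linLoss]
    rw [integral_const_mul, integral_inner (integrable_coe μ h𝒵)]
  rw [genErr, h, meanDev, inner_sub_right, real_inner_smul_right, inner_sum]
  simp only [empRisk, linLoss, ← Finset.mul_sum]
  ring

theorem norm_meanDev_le (h𝒵 : 𝒵 ⊆ Metric.closedBall 0 1) (hn : 1 ≤ n) (s : Fin n → 𝒵) :
    ‖meanDev μ s‖ ≤ 2 := by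
  have hn' : (0 : ℝ) < n := by exact_mod_cast hn
  have h1 : ‖(1 / (n : ℝ)) • ∑ i, (s i : Vec D)‖ ≤ 1 := by
    rw [norm_smul, Real.norm_of_nonneg (by positivity), one_div, inv_mul_le_iff₀ hn']
    refine (norm_sum_le _ _).trans ?_
    exact (Finset.sum_le_sum (g := fun _ => (1 : ℝ)) fun i _ => norm_coe_le_one h𝒵 _).trans (by simp)
  have h2 : ‖∫ z, (z : Vec D) ∂μ‖ ≤ 1 := by
    have := norm_integral_le_of_norm_le_const (μ := μ) (f := fun z : 𝒵 => (z : Vec D))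
      (Filter.Eventually.of_forall (norm_coe_le_one h𝒵))
    simpa using this
  exact (norm_sub_le _ _).trans (by linarith)

/-- Each coordinate of the deviation is a sum of independent centered terms, so its second moment is
a variance divided by `n`. Summed over coordinates, the variances are at most `E ‖z‖² ≤ 1`,
independently of `D`. -/
theorem integral_norm_meanDev_sq_le (h𝒵 : 𝒵 ⊆ Metric.closedBall 0 1) (hn : 1 ≤ n) :
    ∫ s : Fin n → 𝒵, ‖meanDev μ s‖ ^ 2 ∂(sampleLaw μ n) ≤ 1 / n := by
  have hn' : (n : ℝ) ≠ 0 := by positivity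
  set m : Vec D := ∫ z, (z : Vec D) ∂μ with hm
  have hcoord : ∀ k : Fin D, MemLp (fun z : 𝒵 => (z : Vec D) k) 2 μ := fun k => by
    refine MemLp.of_bound (by fun_prop : Measurable fun z : 𝒵 => (z : Vec D) k).aestronglyMeasurable
      1 (Filter.Eventually.of_forall fun z => ?_)
    exact (PiLp.norm_apply_le _ _).trans (norm_coe_le_one h𝒵 z)
  have hmk : ∀ k, ∫ z : 𝒵, (z : Vec D) k ∂μ = m k := fun k =>
    (ContinuousLinearMap.integral_comp_comm (EuclideanSpace.proj k : Vec D →L[ℝ] ℝ)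
      (integrable_coe μ h𝒵))
  have hX : ∀ k, MemLp (fun z : 𝒵 => (1 / (n : ℝ)) * ((z : Vec D) k - m k)) 2 μ := fun k =>
    ((hcoord k).sub (memLp_const _)).const_mul _
  have hX0 : ∀ k, ∫ z : 𝒵, (1 / (n : ℝ)) * ((z : Vec D) k - m k) ∂μ = 0 := fun k => by
    rw [integral_const_mul, integral_sub ((hcoord k).integrable one_le_two) (integrable_const _),
      hmk]
    simp
  have hdev : ∀ (s : Fin n → 𝒵) k, meanDev μ s k =
      ∑ i, (1 / (n : ℝ)) * ((s i : Vec D) k - m k) := fun s k => by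
    simp [meanDev, ← hm, ← Finset.mul_sum, Finset.sum_sub_distrib, mul_sub, hn']
  have hk : ∀ k, ∫ s : Fin n → 𝒵, meanDev μ s k ^ 2 ∂(sampleLaw μ n) ≤
      (1 / n) * ∫ z : 𝒵, (z : Vec D) k ^ 2 ∂μ := fun k => by
    simp_rw [hdev]
    rw [sampleLaw, integral_sum_sq_pi (fun _ => hX k) (fun _ => hX0 k)]
    simp_rw [mul_pow]
    rw [integral_const_mul, Finset.sum_const, Finset.card_univ, Fintype.card_fin, nsmul_eq_mul,
      ← mul_assoc]
    have e : (n : ℝ) * (1 / n) ^ 2 = 1 / n := by field_simp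
    rw [e]
    refine mul_le_mul_of_nonneg_left ?_ (by positivity)
    -- Centering only decreases the second moment.
    have h1 := variance_eq_sub (hcoord k)
    have h2 := variance_eq_integral (μ := μ) (hcoord k).aemeasurable
    rw [hmk] at h1 h2
    rw [← h2, h1]
    exact sub_le_self _ (sq_nonneg _)
  have hdi : ∀ k, Integrable (fun s : Fin n → 𝒵 => meanDev μ s k ^ 2) (sampleLaw μ n) := fun k => by
    refine Integrable.of_bound (C := 4) ?_ (Filter.Eventually.of_forall fun s => ?_)
    · have := measurable_meanDev (n := n) μ
      exact Measurable.aestronglyMeasurable (by fun_prop)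
    · have h1 := (PiLp.norm_apply_le (meanDev μ s) k).trans (norm_meanDev_le μ h𝒵 hn s)
      rw [norm_pow]
      nlinarith [norm_nonneg (meanDev μ s k)]
  have hci : ∀ k, Integrable (fun z : 𝒵 => (z : Vec D) k ^ 2) μ := fun k => (hcoord k).integrable_sq
  simp_rw [EuclideanSpace.norm_sq_eq, Real.norm_eq_abs, sq_abs]
  rw [integral_finsetSum _ fun k _ => hdi k]
  refine (Finset.sum_le_sum fun k _ => hk k).trans ?_
  rw [← Finset.mul_sum, ← integral_finsetSum _ fun k _ => hci k]
  refine mul_le_of_le_one_right (by positivity) ?_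
  have hle : ∀ z : 𝒵, ∑ k, (z : Vec D) k ^ 2 ≤ 1 := fun z => by
    have h1 := norm_coe_le_one h𝒵 z
    have h2 := EuclideanSpace.norm_sq_eq (z : Vec D)
    simp_rw [Real.norm_eq_abs, sq_abs] at h2
    rw [← h2]
    nlinarith [norm_nonneg (z : Vec D)]
  exact (integral_mono (integrable_finsetSum _ fun k _ => hci k) (integrable_const 1) hle).trans
    (by simp)

theorem integral_norm_meanDev_le (h𝒵 : 𝒵 ⊆ Metric.closedBall 0 1) (hn : 1 ≤ n) :
    ∫ s : Fin n → 𝒵, ‖meanDev μ s‖ ∂(sampleLaw μ n) ≤ 1 / Real.sqrt n := by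
  have h := integral_le_sqrt_of_integral_sq_le (X := fun s : Fin n → 𝒵 => ‖meanDev μ s‖)
    (MemLp.of_bound (measurable_meanDev μ).norm.aestronglyMeasurable 2
      (Filter.Eventually.of_forall fun s => by simpa using norm_meanDev_le μ h𝒵 hn s))
    (integral_norm_meanDev_sq_le μ h𝒵 hn)
  rwa [Real.sqrt_div zero_le_one, Real.sqrt_one] at h

end LinearLoss

/-! ### Truncation and dithering: support and domination. -/

section Quantization

open Metric

variable {d : ℕ}

theorem norm_truncate_le {r : ℝ} (hr : 0 ≤ r) (x : Vec d) : ‖truncate r x‖ ≤ r := by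
  unfold truncate; split_ifs with h
  · exact h
  · simpa using hr

theorem measurable_truncate (r : ℝ) : Measurable (truncate r : Vec d → Vec d) := by
  unfold truncate
  exact Measurable.ite (measurableSet_le measurable_norm measurable_const) measurable_id
    measurable_const

theorem isProbabilityMeasure_cond_closedBall {r : ℝ} (hr : 0 < r) :
    IsProbabilityMeasure ((volume : Measure (Vec d))[|closedBall (0 : Vec d) r]) :=
  cond_isProbabilityMeasure_of_finite (measure_closedBall_pos _ _ hr).ne'
    measure_closedBall_lt_top.ne

theorem jlKernel_apply (c ν R : ℝ) (x : Vec d) :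
    jlKernel d c ν R x = ((volume : Measure (Vec d))[|closedBall (0 : Vec d) ν]).map
      (fun v => truncate (c * R) x + R • v) := by
  have hm : Measurable fun p : Vec d × Vec d => truncate (c * R) p.1 + R • p.2 :=
    ((measurable_truncate _).comp measurable_fst).add (measurable_snd.const_smul R)
  rw [jlKernel, Kernel.map_apply _ hm, Kernel.prod_apply, Kernel.id_apply, Kernel.const_apply,
    Measure.dirac_prod, Measure.map_map hm (by fun_prop)]
  rfl

theorem isMarkovKernel_jlKernel (c : ℝ) {ν : ℝ} (hν : 0 < ν) (R : ℝ) :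
    IsMarkovKernel (jlKernel d c ν R) := by
  refine ⟨fun x => ?_⟩
  have := isProbabilityMeasure_cond_closedBall (d := d) hν
  rw [jlKernel_apply]
  exact Measure.isProbabilityMeasure_map (by fun_prop)

theorem jlKernel_mem_closedBall {c ν R : ℝ} (hc : 0 ≤ c) (hR : 0 ≤ R) (x : Vec d) :
    ∀ᵐ v ∂(jlKernel d c ν R x), v ∈ closedBall (0 : Vec d) ((c + ν) * R) := by
  rw [jlKernel_apply, ae_map_iff (p := (· ∈ closedBall (0 : Vec d) ((c + ν) * R))) (by fun_prop)
    isClosed_closedBall.measurableSet]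
  filter_upwards [ae_cond_mem (μ := (volume : Measure (Vec d)))
    (isClosed_closedBall (x := (0 : Vec d)) (ε := ν)).measurableSet] with v hv
  rw [mem_closedBall_zero_iff] at hv ⊢
  have h1 := norm_truncate_le (mul_nonneg hc hR) x
  have h2 : ‖R • v‖ ≤ R * ν := by
    rw [norm_smul, Real.norm_of_nonneg hR]; exact mul_le_mul_of_nonneg_left hv hR
  exact (norm_add_le _ _).trans (by linarith)

/-- The quantization kernel is dominated by the uniform law on a ball. -/
theorem jlKernel_le_smul {c ν R : ℝ} (hc : 0 ≤ c) (hν : 0 < ν) (hR : 0 < R) (x : Vec d) :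
    jlKernel d c ν R x ≤ ENNReal.ofReal (((c + ν) / ν) ^ d) •
      (volume : Measure (Vec d))[|closedBall (0 : Vec d) ((c + ν) * R)] := by
  have hcν : 0 < c + ν := by linarith
  set y := truncate (c * R) x with hy
  have hyn : ‖y‖ ≤ c * R := norm_truncate_le (mul_nonneg hc hR.le) x
  refine Measure.le_iff.mpr fun s hs => ?_
  have hf : Measurable fun v : Vec d => y + R • v := by fun_prop
  rw [jlKernel_apply, ← hy, Measure.map_apply hf hs, Measure.smul_apply, smul_eq_mul,
    cond_apply isClosed_closedBall.measurableSet, cond_apply isClosed_closedBall.measurableSet]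
  -- As `‖y‖ ≤ c R`, the dithering ball of radius `ν R` around `y` lies in the fixed ball of radius
  -- `(c + ν) R`.
  have hsub : closedBall (0 : Vec d) ν ∩ (fun v => y + R • v) ⁻¹' s ⊆
      (fun v => R • v) ⁻¹' ((fun v => y + v) ⁻¹' (closedBall (0 : Vec d) ((c + ν) * R) ∩ s)) := by
    rintro v ⟨hv, hvs⟩
    refine ⟨?_, hvs⟩
    rw [mem_closedBall_zero_iff] at hv ⊢
    have h2 : ‖R • v‖ ≤ R * ν := by
      rw [norm_smul, Real.norm_of_nonneg hR.le]; exact mul_le_mul_of_nonneg_left hv hR.le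
    exact (norm_add_le _ _).trans (by linarith)
  have hvol : volume ((fun v : Vec d => R • v) ⁻¹' ((fun v => y + v) ⁻¹'
      (closedBall (0 : Vec d) ((c + ν) * R) ∩ s))) =
      ENNReal.ofReal ((R ^ d)⁻¹) * volume (closedBall (0 : Vec d) ((c + ν) * R) ∩ s) := by
    rw [Measure.addHaar_preimage_smul _ hR.ne', measure_preimage_add, finrank_euclideanSpace_fin,
      abs_of_pos (by positivity)]
  have hb1 : volume (closedBall (0 : Vec d) ν) =
      ENNReal.ofReal (ν ^ d) * volume (ball (0 : Vec d) 1) := by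
    rw [Measure.addHaar_closedBall _ _ hν.le, finrank_euclideanSpace_fin]
  have hb2 : volume (closedBall (0 : Vec d) ((c + ν) * R)) =
      ENNReal.ofReal (((c + ν) * R) ^ d) * volume (ball (0 : Vec d) 1) := by
    rw [Measure.addHaar_closedBall _ _ (by positivity), finrank_euclideanSpace_fin]
  have hB0 : volume (ball (0 : Vec d) 1) ≠ 0 := (measure_ball_pos _ _ one_pos).ne'
  have hBt : volume (ball (0 : Vec d) 1) ≠ ∞ := measure_ball_lt_top.ne
  refine (mul_le_mul_right (measure_mono hsub) _).trans (le_of_eq ?_)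
  rw [hvol, hb1, hb2, ENNReal.mul_inv (by simp [hBt]) (by simp [hB0]),
    ENNReal.mul_inv (by simp [hBt]) (by simp [hB0]),
    ← ENNReal.ofReal_inv_of_pos (by positivity), ← ENNReal.ofReal_inv_of_pos (by positivity)]
  -- The constant is the ratio of the volumes of the two balls; the volume of the unit ball cancels.
  have e : (ν ^ d)⁻¹ * (R ^ d)⁻¹ = ((c + ν) / ν) ^ d * (((c + ν) * R) ^ d)⁻¹ := by
    rw [div_pow, mul_pow]; field_simp
  have e' := congrArg ENNReal.ofReal e
  rw [ENNReal.ofReal_mul (by positivity), ENNReal.ofReal_mul (by positivity)] at e'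
  calc _ = (ENNReal.ofReal (ν ^ d)⁻¹ * ENNReal.ofReal (R ^ d)⁻¹) *
        (volume (ball (0 : Vec d) 1))⁻¹ * volume (closedBall (0 : Vec d) ((c + ν) * R) ∩ s) := by
        ring
    _ = _ := by rw [e']; ring

variable {Z : Type*} [MeasurableSpace Z] {D n : ℕ} {𝒲 : Set (Vec D)}

/-- Domination uniform in the input survives averaging over the trained model, so nothing about `A`
enters. -/
theorem compressed_le_smul (A : Kernel (Fin n → Z) 𝒲) [IsMarkovKernel A]
    {Q : Kernel (Vec d) (Vec d)} {q : Measure (Vec d)} {C : ℝ≥0∞} (h : ∀ x, Q x ≤ C • q)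
    (Θ : ProjMat D d) (s : Fin n → Z) : compressed A Q Θ s ≤ C • q := by
  have := Kernel.IsMarkovKernel.map A (measurable_proj_coe (𝒲 := 𝒲) Θ)
  refine Measure.le_iff.mpr fun t ht => ?_
  rw [compressed, Kernel.comp_apply' _ _ _ ht]
  exact (lintegral_mono fun x => h x t).trans (by simp)

theorem compressed_ae (A : Kernel (Fin n → Z) 𝒲)
    {Q : Kernel (Vec d) (Vec d)} {t : Set (Vec d)} (ht : MeasurableSet t)
    (h : ∀ x, ∀ᵐ v ∂(Q x), v ∈ t) (Θ : ProjMat D d) (s : Fin n → Z) :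
    ∀ᵐ v ∂(compressed A Q Θ s), v ∈ t := by
  rw [ae_iff]
  change compressed A Q Θ s tᶜ = 0
  rw [compressed, Kernel.comp_apply' _ _ _ ht.compl]
  exact (lintegral_congr fun x => ae_iff.mp (h x)).trans (by simp)

theorem bitsModelLaw_snd_ae (A : Kernel (Fin n → Z) 𝒲) [IsMarkovKernel A]
    {Q : Kernel (Vec d) (Vec d)} [IsMarkovKernel Q] {t : Set (Vec d)} (ht : MeasurableSet t)
    (h : ∀ x, ∀ᵐ v ∂(Q x), v ∈ t) (S : Fin n → Fin 2 → Z) (Θ : ProjMat D d) :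
    ∀ᵐ v ∂(bitsModelLaw A Q S Θ).snd, v ∈ t := by
  rw [Measure.snd, ae_map_iff (p := (· ∈ t)) measurable_snd.aemeasurable ht, bitsModelLaw,
    Measure.ae_compProd_iff (measurable_snd ht)]
  exact Filter.Eventually.of_forall fun J => compressed_ae A ht h Θ _

/-- Domination of the quantization kernel bounds the conditional mutual information. -/
theorem dcmi_le_log (A : Kernel (Fin n → Z) 𝒲) [IsMarkovKernel A]
    {Q : Kernel (Vec d) (Vec d)} [IsMarkovKernel Q] {q : Measure (Vec d)} [IsProbabilityMeasure q]
    {C : ℝ} (hC : 1 ≤ C) (h : ∀ x, Q x ≤ ENNReal.ofReal C • q) (S : Fin n → Fin 2 → Z)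
    (Θ : ProjMat D d) : dcmi A Q S Θ ≤ ENNReal.ofReal (Real.log C) := by
  have hfst : (bitsModelLaw A Q S Θ).fst = bitsLaw n := by
    unfold bitsModelLaw; exact Measure.fst_compProd _ _
  -- Replacing the unknown output marginal by `q` only increases the divergence.
  refine (klDiv_fst_prod_snd_le _ q).trans (klDiv_le_log_of_le_smul hC ?_)
  rw [hfst]
  refine Measure.le_iff.mpr fun t ht => ?_
  rw [bitsModelLaw, Measure.compProd_apply ht, Measure.smul_apply, Measure.prod_apply ht,
    smul_eq_mul, ← lintegral_const_mul _ (measurable_measure_prodMk_left ht)]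
  exact lintegral_mono fun J => compressed_le_smul A h Θ _ _

end Quantization

/-! ### The estimates for the convex problem instance. -/

section Instance

variable {D n : ℕ} {𝒵 : Set (Vec D)} {L R : ℝ}

theorem abs_apply_zero_le {r : ℝ} {v : Vec 1} (hv : v ∈ Metric.closedBall (0 : Vec 1) r) :
    |v 0| ≤ r :=
  (PiLp.norm_apply_le v 0).trans (mem_closedBall_zero_iff.mp hv)

theorem linLoss_sub (z z' : 𝒵) (Θ : ProjMat D 1) (v : Vec 1) :
    linLoss L 𝒵 z (unproj Θ v) - linLoss L 𝒵 z' (unproj Θ v) =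
      -L * (v 0 * colInner Θ ((z : Vec D) - z')) := by
  rw [← inner_unproj, inner_sub_right]
  simp only [linLoss]
  ring

/-- The mean squared projected difference of the pairs of a super-sample. -/
def meanSqDiff (S : Fin n → Fin 2 → 𝒵) (Θ : ProjMat D 1) : ℝ :=
  (1 / (n : ℝ)) * ∑ i, colInner Θ ((S i 0 : Vec D) - S i 1) ^ 2

theorem meanSqDiff_nonneg (S : Fin n → Fin 2 → 𝒵) (Θ : ProjMat D 1) : 0 ≤ meanSqDiff S Θ := by
  unfold meanSqDiff; positivity

theorem integrable_meanSqDiff (S : Fin n → Fin 2 → 𝒵) :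
    Integrable (meanSqDiff S) (jlLaw D 1) :=
  (integrable_finsetSum _ fun _ _ => (memLp_colInner _).integrable_sq).const_mul _

/-- Two points of the unit ball are at distance at most `2`, and the Gaussian column preserves
squared norms on average. -/
theorem integral_meanSqDiff_le (h𝒵 : 𝒵 ⊆ Metric.closedBall 0 1) (hn : 1 ≤ n)
    (S : Fin n → Fin 2 → 𝒵) : ∫ Θ, meanSqDiff S Θ ∂(jlLaw D 1) ≤ 4 := by
  have hn' : (0 : ℝ) < n := by exact_mod_cast hn
  simp only [meanSqDiff]
  rw [integral_const_mul, integral_finsetSum _ fun _ _ => (memLp_colInner _).integrable_sq,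
    one_div, inv_mul_le_iff₀ hn']
  refine (Finset.sum_le_sum (g := fun _ => (4 : ℝ)) fun i _ => ?_).trans (by simp)
  rw [integral_colInner_sq]
  have h : ‖(S i 0 : Vec D) - S i 1‖ ≤ 2 :=
    (norm_sub_le _ _).trans (by linarith [norm_coe_le_one h𝒵 (S i 0), norm_coe_le_one h𝒵 (S i 1)])
  nlinarith [norm_nonneg ((S i 0 : Vec D) - S i 1)]

theorem lossGap_linLoss_le {r : ℝ}
    (A : Kernel (Fin n → 𝒵) (Metric.closedBall (0 : Vec D) R)) [IsMarkovKernel A]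
    {Q : Kernel (Vec 1) (Vec 1)} [IsMarkovKernel Q]
    (hQ : ∀ x, ∀ᵐ v ∂(Q x), v ∈ Metric.closedBall (0 : Vec 1) r)
    (S : Fin n → Fin 2 → 𝒵) (Θ : ProjMat D 1) :
    lossGap (linLoss L 𝒵) A Q S Θ ≤ ENNReal.ofReal ((L * r) ^ 2 * meanSqDiff S Θ) := by
  have hprob : IsProbabilityMeasure (bitsModelLaw A Q S Θ).snd := inferInstance
  unfold lossGap
  calc _ ≤ ∫⁻ _, ENNReal.ofReal ((L * r) ^ 2 * meanSqDiff S Θ) ∂(bitsModelLaw A Q S Θ).snd := ?_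
    _ = _ := by simp
  refine lintegral_mono_ae ?_
  filter_upwards [bitsModelLaw_snd_ae A Metric.isClosed_closedBall.measurableSet hQ S Θ] with v hv
  refine ENNReal.ofReal_le_ofReal ?_
  have hv2 : v 0 ^ 2 ≤ r ^ 2 := by
    have := abs_apply_zero_le hv
    exact sq_le_sq' (abs_le.mp this).1 (abs_le.mp this).2
  simp_rw [linLoss_sub]
  unfold meanSqDiff
  have e : (L * r) ^ 2 * ((1 / (n : ℝ)) * ∑ i, colInner Θ ((S i 0 : Vec D) - S i 1) ^ 2) =
      (1 / (n : ℝ)) * ∑ i, (L * r) ^ 2 * colInner Θ ((S i 0 : Vec D) - S i 1) ^ 2 := by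
    rw [← Finset.mul_sum]; ring
  rw [e]
  have hn0 : (0 : ℝ) ≤ 1 / n := by positivity
  refine mul_le_mul_of_nonneg_left (Finset.sum_le_sum fun i _ => ?_) hn0
  calc (-L * (v 0 * colInner Θ ((S i 0 : Vec D) - S i 1))) ^ 2
      = L ^ 2 * v 0 ^ 2 * colInner Θ ((S i 0 : Vec D) - S i 1) ^ 2 := by ring
    _ ≤ L ^ 2 * r ^ 2 * colInner Θ ((S i 0 : Vec D) - S i 1) ^ 2 :=
        mul_le_mul_of_nonneg_right (mul_le_mul_of_nonneg_left hv2 (sq_nonneg L)) (sq_nonneg _)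
    _ = _ := by ring

/-- Here `7 / 2 = (1 + 2/5) / (2/5)` is the density bound of the kernel; `exp 1 ≥ 2` already gives
`exp 2 ≥ 4`. -/
theorem log_seven_halves_le : Real.log (7 / 2) ≤ 2 := by
  rw [Real.log_le_iff_le_exp (by norm_num)]
  have h1 := Real.add_one_le_exp (1 : ℝ)
  have h2 : Real.exp 2 = Real.exp 1 * Real.exp 1 := by rw [← Real.exp_add]; norm_num
  rw [h2]; nlinarith

theorem jlKernel_one_mem (hR : 0 ≤ R) (x : Vec 1) :
    ∀ᵐ v ∂(jlKernel 1 1 (2 / 5) R x), v ∈ Metric.closedBall (0 : Vec 1) (7 / 5 * R) := by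
  have h := jlKernel_mem_closedBall (d := 1) (c := 1) (ν := 2 / 5) zero_le_one hR x
  have e : (1 + 2 / 5 : ℝ) = 7 / 5 := by norm_num
  rwa [e] at h

instance : IsMarkovKernel (jlKernel 1 1 (2 / 5) R) :=
  isMarkovKernel_jlKernel 1 (by norm_num) R

theorem dcmi_jlKernel_le (hR : 0 < R) (A : Kernel (Fin n → 𝒵) (Metric.closedBall (0 : Vec D) R))
    [IsMarkovKernel A] (S : Fin n → Fin 2 → 𝒵) (Θ : ProjMat D 1) :
    dcmi A (jlKernel 1 1 (2 / 5) R) S Θ ≤ ENNReal.ofReal 2 := by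
  have := isProbabilityMeasure_cond_closedBall (d := 1)
    (by positivity : (0 : ℝ) < (1 + 2 / 5) * R)
  have h := dcmi_le_log A (C := ((1 + 2 / 5) / (2 / 5)) ^ 1) (by norm_num)
    (fun x => jlKernel_le_smul (d := 1) zero_le_one (by norm_num : (0 : ℝ) < 2 / 5) hR x) S Θ
  refine h.trans (ENNReal.ofReal_le_ofReal ?_)
  have e : ((1 + 2 / 5 : ℝ) / (2 / 5)) ^ 1 = 7 / 2 := by norm_num
  rw [e]; exact log_seven_halves_le

theorem cmiTerm_integrand_le (hR : 0 ≤ R)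
    (A : Kernel (Fin n → 𝒵) (Metric.closedBall (0 : Vec D) R)) [IsMarkovKernel A]
    (S : Fin n → Fin 2 → 𝒵) (Θ : ProjMat D 1) :
    (ENNReal.ofReal (2 / (n : ℝ)) * lossGap (linLoss L 𝒵) A (jlKernel 1 1 (2 / 5) R) S Θ *
      dcmi A (jlKernel 1 1 (2 / 5) R) S Θ) ^ (1 / 2 : ℝ) ≤
    ENNReal.ofReal (Real.sqrt (4 / n * (L * (7 / 5 * R)) ^ 2 * meanSqDiff S Θ)) := by
  have hW := meanSqDiff_nonneg S Θ
  have hgap := lossGap_linLoss_le (L := L) A (jlKernel_one_mem hR) S Θ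
  rw [Real.sqrt_eq_rpow, ← ENNReal.ofReal_rpow_of_nonneg (by positivity) (by norm_num)]
  refine ENNReal.rpow_le_rpow ?_ (by norm_num)
  rcases hR.eq_or_lt with h0 | hpos
  -- For `R = 0` the domination argument is unavailable, but `Ŵ = 0` almost surely and the loss gap
  -- vanishes.
  · have hz : lossGap (linLoss L 𝒵) A (jlKernel 1 1 (2 / 5) R) S Θ = 0 := by
      refine le_antisymm (hgap.trans (le_of_eq ?_)) zero_le
      simp [← h0]
    rw [hz, mul_zero, zero_mul]
    exact zero_le
  · calc _ ≤ ENNReal.ofReal (2 / (n : ℝ)) *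
          ENNReal.ofReal ((L * (7 / 5 * R)) ^ 2 * meanSqDiff S Θ) * ENNReal.ofReal 2 := by
          gcongr; exact dcmi_jlKernel_le hpos A S Θ
      _ = _ := by
          rw [← ENNReal.ofReal_mul (by positivity), ← ENNReal.ofReal_mul (by positivity)]
          congr 1
          ring

theorem cmiTerm_jlKernel_le (hL : 0 ≤ L) (hR : 0 ≤ R) (h𝒵 : 𝒵 ⊆ Metric.closedBall 0 1)
    (hn : 1 ≤ n) (μ : Measure 𝒵) [IsProbabilityMeasure μ]
    (A : Kernel (Fin n → 𝒵) (Metric.closedBall (0 : Vec D) R)) [IsMarkovKernel A] :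
    cmiTerm μ (linLoss L 𝒵) A (jlLaw D 1) (jlKernel 1 1 (2 / 5) R) ≤
      ENNReal.ofReal (28 / 5 * L * R / Real.sqrt n) := by
  have hn' : (0 : ℝ) < n := by exact_mod_cast hn
  have hS : ∀ S : Fin n → Fin 2 → 𝒵, ∫⁻ Θ, ENNReal.ofReal
      (Real.sqrt (4 / n * (L * (7 / 5 * R)) ^ 2 * meanSqDiff S Θ)) ∂(jlLaw D 1) ≤
      ENNReal.ofReal (28 / 5 * L * R / Real.sqrt n) := by
    intro S
    have hint : Integrable (fun Θ => 4 / n * (L * (7 / 5 * R)) ^ 2 * meanSqDiff S Θ)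
        (jlLaw D 1) := (integrable_meanSqDiff S).const_mul _
    have hsq : ∀ Θ, Real.sqrt (4 / n * (L * (7 / 5 * R)) ^ 2 * meanSqDiff S Θ) ^ 2 =
        4 / n * (L * (7 / 5 * R)) ^ 2 * meanSqDiff S Θ := fun Θ =>
      Real.sq_sqrt (mul_nonneg (by positivity) (meanSqDiff_nonneg S Θ))
    have hX : MemLp (fun Θ => Real.sqrt (4 / n * (L * (7 / 5 * R)) ^ 2 * meanSqDiff S Θ)) 2
        (jlLaw D 1) := by
      rw [memLp_two_iff_integrable_sq
        (Real.continuous_sqrt.comp_aestronglyMeasurable hint.aestronglyMeasurable)]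
      simpa only [hsq] using hint
    rw [← ofReal_integral_eq_lintegral_ofReal (hX.integrable one_le_two)
      (Filter.Eventually.of_forall fun _ => Real.sqrt_nonneg _)]
    refine ENNReal.ofReal_le_ofReal ?_
    -- Jensen moves the expectation over `Θ` under the root. The resulting bound is uniform in `S`,
    -- so the outer integral costs nothing.
    refine (integral_le_sqrt_of_integral_sq_le hX (b := 4 / n * (L * (7 / 5 * R)) ^ 2 * 4) ?_).trans
      (le_of_eq ?_)
    · simp_rw [hsq]
      rw [integral_const_mul]
      exact mul_le_mul_of_nonneg_left (integral_meanSqDiff_le h𝒵 hn S) (by positivity)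
    · have e : 4 / n * (L * (7 / 5 * R)) ^ 2 * 4 = (28 / 5 * L * R) ^ 2 / n := by ring
      rw [e, Real.sqrt_div (sq_nonneg _), Real.sqrt_sq (by positivity)]
  unfold cmiTerm
  refine (lintegral_mono fun S => (lintegral_mono fun Θ =>
    cmiTerm_integrand_le hR A S Θ).trans (hS S)).trans ?_
  simp

theorem measurePreserving_sample_proj (μ : Measure 𝒵) [IsProbabilityMeasure μ]
    {𝒲 : Set (Vec D)} (A : Kernel (Fin n → 𝒵) 𝒲) [IsMarkovKernel A]
    {d : ℕ} (P : Measure (ProjMat D d)) [IsProbabilityMeasure P] (Q : Kernel (Vec d) (Vec d))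
    [IsMarkovKernel Q] :
    MeasurePreserving (fun p => (p.1.1.1, p.1.2)) (fullLaw μ A P Q) ((sampleLaw μ n).prod P) := by
  have h1 : MeasurePreserving Prod.fst (trainLaw μ A) (sampleLaw μ n) :=
    ⟨measurable_fst, by unfold trainLaw; exact Measure.fst_compProd _ _⟩
  exact (h1.prod (MeasurePreserving.id P)).comp ⟨measurable_fst, fst_fullLaw μ A P Q⟩

theorem memLp_colInner_meanDev (h𝒵 : 𝒵 ⊆ Metric.closedBall 0 1) (hn : 1 ≤ n) (μ : Measure 𝒵)
    [IsProbabilityMeasure μ] :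
    MemLp (fun p : (Fin n → 𝒵) × ProjMat D 1 => |colInner p.2 (meanDev μ p.1)|) 2
      ((sampleLaw μ n).prod (jlLaw D 1)) := by
  have hsum : MemLp (fun Θ : ProjMat D 1 => 2 * ∑ i, |Θ i 0|) 2 (jlLaw D 1) :=
    (memLp_finsetSum _ fun i _ => (memLp_eval_jlLaw i).abs).const_mul 2
  refine MemLp.mono (hsum.comp_measurePreserving
    (measurePreserving_snd (μ := sampleLaw μ n) (ν := jlLaw D 1))) ?_ ?_
  · have h := measurable_colInner.comp
      (measurable_snd.prodMk ((measurable_meanDev (n := n) μ).comp measurable_fst) :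
        Measurable fun p : (Fin n → 𝒵) × ProjMat D 1 => (p.2, meanDev μ p.1))
    exact (measurable_norm.comp h).aestronglyMeasurable
  · refine Filter.Eventually.of_forall fun p => ?_
    have h0 : 0 ≤ ∑ i, |p.2 i 0| := Finset.sum_nonneg fun i _ => abs_nonneg _
    simp only [Function.comp, Real.norm_eq_abs, abs_abs]
    exact ((abs_colInner_le _ _).trans
      (mul_le_mul_of_nonneg_right (norm_meanDev_le μ h𝒵 hn p.1) h0)).trans (le_abs_self _)

/-- `Θ` is independent of the sample, so given `s` the second moment of the projected deviation is
`‖meanDev μ s‖²`. -/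
theorem integral_colInner_meanDev_le (h𝒵 : 𝒵 ⊆ Metric.closedBall 0 1) (hn : 1 ≤ n)
    (μ : Measure 𝒵) [IsProbabilityMeasure μ] :
    ∫ p : (Fin n → 𝒵) × ProjMat D 1, |colInner p.2 (meanDev μ p.1)|
      ∂((sampleLaw μ n).prod (jlLaw D 1)) ≤ 1 / Real.sqrt n := by
  have hm := memLp_colInner_meanDev h𝒵 hn μ
  have h := integral_le_sqrt_of_integral_sq_le hm (b := 1 / n) (by
    rw [integral_prod _ hm.integrable_sq]
    simp only [sq_abs, integral_colInner_sq]
    exact integral_norm_meanDev_sq_le μ h𝒵 hn)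
  rwa [Real.sqrt_div zero_le_one, Real.sqrt_one] at h

theorem abs_genErr_linLoss_le (hL : 0 ≤ L) (h𝒵 : 𝒵 ⊆ Metric.closedBall 0 1) (μ : Measure 𝒵)
    [IsProbabilityMeasure μ] (s : Fin n → 𝒵) (w : Metric.closedBall (0 : Vec D) R) :
    |genErr μ (linLoss L 𝒵) s (w : Vec D)| ≤ L * R * ‖meanDev μ s‖ := by
  rw [genErr_linLoss μ h𝒵, abs_mul, abs_of_nonneg hL, mul_assoc]
  refine mul_le_mul_of_nonneg_left ((abs_real_inner_le_norm _ _).trans ?_) hL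
  exact mul_le_mul_of_nonneg_right (mem_closedBall_zero_iff.mp w.2) (norm_nonneg _)

theorem abs_genErr_unproj_le (hL : 0 ≤ L) (h𝒵 : 𝒵 ⊆ Metric.closedBall 0 1) (μ : Measure 𝒵)
    [IsProbabilityMeasure μ] (s : Fin n → 𝒵) (Θ : ProjMat D 1) {r : ℝ} {v : Vec 1}
    (hv : v ∈ Metric.closedBall (0 : Vec 1) r) :
    |genErr μ (linLoss L 𝒵) s (unproj Θ v)| ≤ L * r * |colInner Θ (meanDev μ s)| := by
  rw [genErr_linLoss μ h𝒵, inner_unproj, abs_mul, abs_of_nonneg hL, abs_mul, mul_assoc]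
  exact mul_le_mul_of_nonneg_left
    (mul_le_mul_of_nonneg_right (abs_apply_zero_le hv) (abs_nonneg _)) hL

theorem measurable_genErr_linLoss (h𝒵 : 𝒵 ⊆ Metric.closedBall 0 1) (μ : Measure 𝒵)
    [IsProbabilityMeasure μ] {X : Type*} [MeasurableSpace X] {s : X → Fin n → 𝒵} {w : X → Vec D}
    (hs : Measurable s) (hw : Measurable w) :
    Measurable fun x => genErr μ (linLoss L 𝒵) (s x) (w x) := by
  simp_rw [genErr_linLoss μ h𝒵]
  exact (hw.inner ((measurable_meanDev μ).comp hs)).const_mul L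

theorem integrable_genErr_linLoss (hL : 0 ≤ L) (hR : 0 ≤ R) (h𝒵 : 𝒵 ⊆ Metric.closedBall 0 1)
    (hn : 1 ≤ n) (μ : Measure 𝒵) [IsProbabilityMeasure μ]
    (A : Kernel (Fin n → 𝒵) (Metric.closedBall (0 : Vec D) R)) [IsMarkovKernel A] :
    Integrable (fun p => genErr μ (linLoss L 𝒵) p.1 (p.2 : Vec D)) (trainLaw μ A) := by
  refine Integrable.of_bound (C := L * R * 2) (measurable_genErr_linLoss h𝒵 μ measurable_fst
    (measurable_subtype_coe.comp measurable_snd)).aestronglyMeasurable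
    (Filter.Eventually.of_forall fun p => ?_)
  exact (abs_genErr_linLoss_le hL h𝒵 μ p.1 p.2).trans
    (mul_le_mul_of_nonneg_left (norm_meanDev_le μ h𝒵 hn p.1) (by positivity))

/-- The distortion of Gaussian projection with truncation and dithering is integrable and of
order `L R / √n`. -/
theorem distortion_jlKernel (hL : 0 ≤ L) (hR : 0 ≤ R) (h𝒵 : 𝒵 ⊆ Metric.closedBall 0 1)
    (hn : 1 ≤ n) (μ : Measure 𝒵) [IsProbabilityMeasure μ]
    (A : Kernel (Fin n → 𝒵) (Metric.closedBall (0 : Vec D) R)) [IsMarkovKernel A] :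
    Integrable (fun p => genErr μ (linLoss L 𝒵) p.1.1.1 (p.1.1.2 : Vec D) -
        genErr μ (linLoss L 𝒵) p.1.1.1 (unproj p.1.2 p.2))
      (fullLaw μ A (jlLaw D 1) (jlKernel 1 1 (2 / 5) R)) ∧
    ∫ p, (genErr μ (linLoss L 𝒵) p.1.1.1 (p.1.1.2 : Vec D) -
        genErr μ (linLoss L 𝒵) p.1.1.1 (unproj p.1.2 p.2))
      ∂(fullLaw μ A (jlLaw D 1) (jlKernel 1 1 (2 / 5) R)) ≤ 12 / 5 * L * R / Real.sqrt n := by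
  have hmp := measurePreserving_sample_proj μ A (jlLaw D 1) (jlKernel 1 1 (2 / 5) R)
  -- No cancellation between `W` and `Θ Ŵ` is used: the two errors are bounded separately, with
  -- weights `1` and `7/5` adding up to `12/5`. The majorant depends on the sample and `Θ` only,
  -- whose joint law is a product.
  let b : (Fin n → 𝒵) × ProjMat D 1 → ℝ := fun q =>
    L * R * ‖meanDev μ q.1‖ + L * (7 / 5 * R) * |colInner q.2 (meanDev μ q.1)|
  have hn1 : Integrable (fun q : (Fin n → 𝒵) × ProjMat D 1 => ‖meanDev μ q.1‖)
      ((sampleLaw μ n).prod (jlLaw D 1)) :=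
    Integrable.of_bound ((measurable_meanDev μ).comp measurable_fst).norm.aestronglyMeasurable 2
      (Filter.Eventually.of_forall fun q => by simpa using norm_meanDev_le μ h𝒵 hn q.1)
  have hn2 := (memLp_colInner_meanDev h𝒵 hn μ).integrable one_le_two
  have hb : Integrable b ((sampleLaw μ n).prod (jlLaw D 1)) :=
    (hn1.const_mul _).add (hn2.const_mul _)
  have hbint : ∫ q, b q ∂((sampleLaw μ n).prod (jlLaw D 1)) ≤ 12 / 5 * L * R / Real.sqrt n := by
    have e1 : ∫ q : (Fin n → 𝒵) × ProjMat D 1, ‖meanDev μ q.1‖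
        ∂((sampleLaw μ n).prod (jlLaw D 1)) ≤ 1 / Real.sqrt n := by
      rw [integral_prod _ hn1]
      simpa using integral_norm_meanDev_le μ h𝒵 hn
    have e2 := integral_colInner_meanDev_le h𝒵 hn μ
    have e : ∫ q, b q ∂((sampleLaw μ n).prod (jlLaw D 1)) =
        L * R * ∫ q : (Fin n → 𝒵) × ProjMat D 1, ‖meanDev μ q.1‖
          ∂((sampleLaw μ n).prod (jlLaw D 1)) +
        L * (7 / 5 * R) * ∫ q : (Fin n → 𝒵) × ProjMat D 1, |colInner q.2 (meanDev μ q.1)|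
          ∂((sampleLaw μ n).prod (jlLaw D 1)) := by
      rw [integral_add (hn1.const_mul _) (hn2.const_mul _), integral_const_mul, integral_const_mul]
    rw [e]
    refine (add_le_add (mul_le_mul_of_nonneg_left e1 (by positivity))
      (mul_le_mul_of_nonneg_left e2 (by positivity))).trans (le_of_eq ?_)
    ring
  have hle : ∀ᵐ p ∂(fullLaw μ A (jlLaw D 1) (jlKernel 1 1 (2 / 5) R)),
      |genErr μ (linLoss L 𝒵) p.1.1.1 (p.1.1.2 : Vec D) -
        genErr μ (linLoss L 𝒵) p.1.1.1 (unproj p.1.2 p.2)| ≤ b (p.1.1.1, p.1.2) := by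
    filter_upwards [ae_fullLaw_of_forall μ A (jlLaw D 1) (jlKernel 1 1 (2 / 5) R)
      Metric.isClosed_closedBall.measurableSet (jlKernel_one_mem hR)] with p hp
    exact (abs_sub _ _).trans (add_le_add (abs_genErr_linLoss_le hL h𝒵 μ _ _)
      (abs_genErr_unproj_le hL h𝒵 μ _ _ hp))
  have hb' := hmp.integrable_comp_of_integrable hb
  have hint : Integrable (fun p => genErr μ (linLoss L 𝒵) p.1.1.1 (p.1.1.2 : Vec D) -
        genErr μ (linLoss L 𝒵) p.1.1.1 (unproj p.1.2 p.2))
      (fullLaw μ A (jlLaw D 1) (jlKernel 1 1 (2 / 5) R)) := by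
    refine hb'.mono' (Measurable.aestronglyMeasurable (Measurable.sub ?_ ?_)) hle
    · exact measurable_genErr_linLoss h𝒵 μ (by fun_prop)
        (measurable_subtype_coe.comp (by fun_prop))
    · exact measurable_genErr_linLoss h𝒵 μ (by fun_prop)
        (measurable_unproj.comp ((measurable_snd.comp measurable_fst).prodMk measurable_snd))
  refine ⟨hint, (integral_mono_ae hint hb' (hle.mono fun p hp => (le_abs_self _).trans hp)).trans ?_⟩
  have e := integral_map (f := b) hmp.measurable.aemeasurable
    (by rw [hmp.map_eq]; exact hb.aestronglyMeasurable)
  rw [hmp.map_eq] at e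
  exact e.symm.le.trans hbint

/-- For linear losses, one-dimensional Gaussian projection with truncation and dithering gives a
generalization bound of order `L R / √n`. -/
theorem cmiBound_linLoss_le (hL : 0 ≤ L) (hR : 0 ≤ R) (h𝒵 : 𝒵 ⊆ Metric.closedBall 0 1)
    (hn : 1 ≤ n) (μ : Measure 𝒵) [IsProbabilityMeasure μ]
    (A : Kernel (Fin n → 𝒵) (Metric.closedBall (0 : Vec D) R)) [IsMarkovKernel A] :
      Integrable (fun p => genErr μ (linLoss L 𝒵) p.1 (p.2 : Vec D))
        (trainLaw μ A) ∧
      expGenErr μ (linLoss L 𝒵) A ≤ 8 * L * R / Real.sqrt n ∧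
      ∃ (What : Set (Vec 1)) (τ : ℝ),
        IsAdmissible μ (linLoss L 𝒵) A What τ
          (jlLaw D 1) (jlKernel 1 1 (2 / 5) R) ∧
        (expGenErr μ (linLoss L 𝒵) A : EReal) ≤
          cmiBound μ (linLoss L 𝒵) A What τ ∧
        cmiBound μ (linLoss L 𝒵) A What τ ≤
          (cmiTerm μ (linLoss L 𝒵) A
            (jlLaw D 1) (jlKernel 1 1 (2 / 5) R) : EReal) + (τ : EReal) ∧
        (cmiTerm μ (linLoss L 𝒵) A
            (jlLaw D 1) (jlKernel 1 1 (2 / 5) R) : EReal) + (τ : EReal) ≤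
          ((8 * L * R / Real.sqrt n : ℝ) : EReal) := by
  have hgen := integrable_genErr_linLoss hL hR h𝒵 hn μ A
  obtain ⟨hint, hdist⟩ := distortion_jlKernel hL hR h𝒵 hn μ A
  -- The level `τ` is left to unification: `le_rfl` makes it the exact distortion.
  have hadm : IsAdmissible μ (linLoss L 𝒵) A
      (Metric.closedBall (0 : Vec 1) (7 / 5 * R)) _
      (jlLaw D 1) (jlKernel 1 1 (2 / 5) R) :=
    ⟨inferInstance, inferInstance, jlKernel_one_mem hR, hint, le_rfl⟩
  have h1 := expGenErr_le_cmiBound (d := 1) μ hn (measurable_linLoss L)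
    (abs_linLoss_le hL h𝒵) A hgen
    (subset_refl (Metric.closedBall (0 : Vec 1) (7 / 5 * R)))
  have h2 := cmiBound_le μ A hadm
  have h3 : (cmiTerm μ (linLoss L 𝒵) A
      (jlLaw D 1) (jlKernel 1 1 (2 / 5) R) : EReal) +
      ((∫ p, (genErr μ (linLoss L 𝒵) p.1.1.1 (p.1.1.2 : Vec D) -
        genErr μ (linLoss L 𝒵) p.1.1.1 (unproj p.1.2 p.2))
        ∂(fullLaw μ A (jlLaw D 1) (jlKernel 1 1 (2 / 5) R)) : ℝ) :
        EReal) ≤ ((8 * L * R / Real.sqrt n : ℝ) : EReal) := by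
    have hT := EReal.coe_ennreal_le_coe_ennreal_iff.mpr
      (cmiTerm_jlKernel_le hL hR h𝒵 hn μ A)
    rw [EReal.coe_ennreal_ofReal, max_eq_left (by positivity)] at hT
    refine (add_le_add hT (EReal.coe_le_coe_iff.mpr hdist)).trans (le_of_eq ?_)
    rw [← EReal.coe_add]
    congr 1
    ring
  -- The bound on `expGenErr` is read off the chain through `cmiBound` itself.
  exact ⟨hgen, EReal.coe_le_coe_iff.mp (((h1 _).trans h2).trans h3), _, _, hadm, h1 _, h2, h3⟩

end Instance

end ProjCMI

end

/-! ### Main theorem and the order of the sample size. -/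

theorem theorem2 :
    -- the bound for every algorithm, dimension, data space and data distribution
    (∀ (D n : ℕ) (_ : 1 ≤ n) (L R : ℝ) (_ : 0 ≤ L) (_ : 0 ≤ R)
        (𝒵 : Set (ProjCMI.Vec D)) (_ : 𝒵 ⊆ Metric.closedBall 0 1)
        (μ : Measure 𝒵) (_ : IsProbabilityMeasure μ)
        (A : Kernel (Fin n → 𝒵) (Metric.closedBall (0 : ProjCMI.Vec D) R))
        (_ : IsMarkovKernel A),
      Integrable (fun p => ProjCMI.genErr μ (ProjCMI.linLoss L 𝒵) p.1 (p.2 : ProjCMI.Vec D))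
        (ProjCMI.trainLaw μ A) ∧
      ProjCMI.expGenErr μ (ProjCMI.linLoss L 𝒵) A ≤ 8 * L * R / Real.sqrt n ∧
      -- it is the value of the projection and compression bound, with projection dimension one
      ∃ (What : Set (ProjCMI.Vec 1)) (τ : ℝ),
        ProjCMI.IsAdmissible μ (ProjCMI.linLoss L 𝒵) A What τ
          (ProjCMI.jlLaw D 1) (ProjCMI.jlKernel 1 1 (2 / 5) R) ∧
        (ProjCMI.expGenErr μ (ProjCMI.linLoss L 𝒵) A : EReal) ≤
          ProjCMI.cmiBound μ (ProjCMI.linLoss L 𝒵) A What τ ∧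
        ProjCMI.cmiBound μ (ProjCMI.linLoss L 𝒵) A What τ ≤
          (ProjCMI.cmiTerm μ (ProjCMI.linLoss L 𝒵) A
            (ProjCMI.jlLaw D 1) (ProjCMI.jlKernel 1 1 (2 / 5) R) : EReal) + (τ : EReal) ∧
        (ProjCMI.cmiTerm μ (ProjCMI.linLoss L 𝒵) A
            (ProjCMI.jlLaw D 1) (ProjCMI.jlKernel 1 1 (2 / 5) R) : EReal) + (τ : EReal) ≤
          ((8 * L * R / Real.sqrt n : ℝ) : EReal)) ∧
    -- at sample sizes of order `(L R / ε) ^ 2` the bound and the generalization error are `O(ε)`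
    (∀ c : ℝ, 0 < c → ∃ C : ℝ, 0 < C ∧
      ∀ (D n : ℕ) (_ : 1 ≤ n) (L R : ℝ) (_ : 0 ≤ L) (_ : 0 ≤ R)
        (𝒵 : Set (ProjCMI.Vec D)) (_ : 𝒵 ⊆ Metric.closedBall 0 1)
        (μ : Measure 𝒵) (_ : IsProbabilityMeasure μ)
        (A : Kernel (Fin n → 𝒵) (Metric.closedBall (0 : ProjCMI.Vec D) R))
        (_ : IsMarkovKernel A) (ε : ℝ) (_ : 0 < ε) (_ : c * (L * R / ε) ^ 2 ≤ (n : ℝ)),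
      ProjCMI.expGenErr μ (ProjCMI.linLoss L 𝒵) A ≤ 8 * L * R / Real.sqrt n ∧
      8 * L * R / Real.sqrt n ≤ C * ε) := by
  refine ⟨fun D n hn L R hL hR 𝒵 h𝒵 μ hμ A hA =>
    ProjCMI.cmiBound_linLoss_le hL hR h𝒵 hn μ A, fun c hc => ⟨8 / Real.sqrt c, by positivity, ?_⟩⟩
  intro D n hn L R hL hR 𝒵 h𝒵 μ hμ A hA ε hε hcn
  refine ⟨(ProjCMI.cmiBound_linLoss_le hL hR h𝒵 hn μ A).2.1, ?_⟩
  have hn' : (0 : ℝ) < n := by exact_mod_cast hn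
  -- Taking roots gives `√c · L R ≤ √n · ε`, whence `C = 8 / √c`.
  have h := Real.sqrt_le_sqrt hcn
  rw [Real.sqrt_mul hc.le, Real.sqrt_sq (by positivity), ← mul_div_assoc, div_le_iff₀ hε] at h
  rw [div_mul_eq_mul_div, div_le_div_iff₀ (Real.sqrt_pos.mpr hn') (Real.sqrt_pos.mpr hc)]
  nlinarith
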